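/- Let $k$ be a field, $R=k[x_0,\dots,x_n]$, let $1\le c<s$ be integers, and let $\mathcal F=\{F_1,\dots,F_s\}$ be forms in $R$ such that any $c+1$ of them form a regular sequence. Let $$I_c=\bigcap_{1\le j_1<\dots<j_c\le s}(F_{j_1},\dots,F_{j_c}),\qquad I_c^{(m)}=\bigcap_{P\in\mathrm{Ass}(R/I_c)}\bigl(I_c^mR_P\cap R\bigr).$$ A monomial in $\mathcal F$ is a product $M=F_1^{a_1}\cdots F_s^{a_s}$; its support is $\mathrm{supp}(M)=\{F_i : a_i>0\}$ (the exponents are uniquely determined by $M$ under the above hypotheses). The normal form of $M$ is the unique factorization $M=M^{(1)}\cdots M^{(t)}$ in which each $M^{(j)}$ is a product of distinct elements of $\mathcal F$ and $\mathrm{supp}(M^{(1)})\supseteq\dots\supseteq\mathrm{supp}(M^{(t)})\neq\emptyset$. Put $\mathrm{Sdeg}(M)=\sum_{j=1}^t\max\{0,\,c-s+|\mathrm{supp}(M^{(j)})|\}$ and, for $m\ge1$, let $\mathbf G_{c,(m)}$ be the set of monomials $M$ in $\mathcal F$ with $\mathrm{Sdeg}(M)=m$ and $|\mathrm{supp}(M^{(j)})|\ge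 s+1-c$ for every $j$. Then for every $m\ge1$ a minimal generating set of the $R$-module $I_c^{(m)}/I_c^m$ is given by (the residue classes, which are pairwise distinct, of) the elements of $$\mathbf G'_{c,(m)}=\{M\in\mathbf G_{c,(m)} : |\mathrm{supp}(M)|\ge s+2-c\}.$$ Equivalently, $\mathbf G'_{c,(m)}$ consists of the monomials $M$ in $\mathcal F$ with $\mathrm{Sdeg}(M)=m$ such that every factor of the normal form of $M$ has support of size at least $s+1-c$ and at least one factor has support of size at least $s+2-c$. In particular $\mathbf G'_{c,(m)}$ is finite, and the symbolic defect of $I_c$, i.e. the minimal number of generators of $I_c^{(m)}/I_c^m$, equals $|\mathbf G'_{c,(m)}|$. -/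

import Mathlib

noncomputable section

namespace StarConfig

section General

variable {R : Type*} [CommRing R]

/-- The `m`-th symbolic power `⋂_{P ∈ Ass(R/I)} (I^m R_P ∩ R)`. -/
def symbolicPower (I : Ideal R) (m : ℕ) : Ideal R :=
  ⨅ P : {P : Ideal R // P ∈ associatedPrimes R (R ⧸ I)},
    haveI : P.1.IsPrime := IsAssociatedPrime.isPrime P.2
    ((I ^ m).map (algebraMap R (Localization.AtPrime P.1))).comap
      (algebraMap R (Localization.AtPrime P.1))

/-- The `R`-module `I^(m) / I^m`. -/
abbrev SymbolicQuotient (I : Ideal R) (m : ℕ) : Type _ :=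
  symbolicPower I m ⧸ (I ^ m).submoduleOf (symbolicPower I m)

/-- The symbolic defect: the minimal number of generators of `I^(m) / I^m`. -/
def sdefect (I : Ideal R) (m : ℕ) : ℕ :=
  (⊤ : Submodule R (SymbolicQuotient I m)).spanFinrank

/-- A family generates the module `W`, and no proper subfamily does.  (In particular the members
of such a family are pairwise distinct.) -/
def IsMinimalGenerating {W ι : Type*} [AddCommGroup W] [Module R W] (v : ι → W) : Prop :=
  Submodule.span R (Set.range v) = ⊤ ∧
    ∀ T : Set ι, Submodule.span R (v '' T) = ⊤ → T = Set.univ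

variable {s : ℕ}

/-- The ideal `⋂_{|T| = c} (F_j : j ∈ T)` of the star configuration of height `c` on `F`. -/
def starIdeal (F : Fin s → R) (c : ℕ) : Ideal R :=
  ⨅ T : {T : Finset (Fin s) // T.card = c}, Ideal.span (F '' (T.1 : Set (Fin s)))

/-- The monomial `∏ F_i ^ a_i` in the family `F`. -/
def monomialIn (F : Fin s → R) (a : Fin s → ℕ) : R := ∏ i, F i ^ a i

/-- The (indices of the) elements of `F` which occur in an expression of `M` as a monomial in `F`.
When such expressions are unique this is the support of `M`. -/
def supp (F : Fin s → R) (M : R) : Set (Fin s) :=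
  {i | ∃ a : Fin s → ℕ, M = monomialIn F a ∧ a i ≠ 0}

/-- `L = [S₁, …, S_t]` encodes a normal form `M = M⁽¹⁾ ⋯ M⁽ᵗ⁾`, where `M⁽ʲ⁾ = ∏_{i ∈ S_j} F_i` and
`S₁ ⊇ S₂ ⊇ ⋯ ⊇ S_t ≠ ∅`. -/
structure IsNormalForm (F : Fin s → R) (M : R) (L : List (Finset (Fin s))) : Prop where
  nonempty : ∀ S ∈ L, S.Nonempty
  antitone : L.Pairwise (fun S S' => S' ⊆ S)
  eq_prod : M = (L.map fun S => ∏ i ∈ S, F i).prod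

/-- The symbolic degree `∑_j max(0, c - s + |S_j|)` of a monomial with normal form `[S₁, …, S_t]`;
the truncated subtraction of `ℕ` provides the maximum with `0`. -/
def sdeg (c : ℕ) (L : List (Finset (Fin s))) : ℕ :=
  (L.map fun S => (c + S.card) - s).sum

/-- The set `G_{c,(m)}`: monomials of symbolic degree `m` all of whose normal form factors have
support of size at least `s + 1 - c`. -/
def gens (F : Fin s → R) (c m : ℕ) : Set R :=
  {M | ∃ L, IsNormalForm F M L ∧ sdeg c L = m ∧ ∀ S ∈ L, s + 1 - c ≤ S.card}

/-- The set `G'_{c,(m)}`: elements of `G_{c,(m)}` with support of size at least `s + 2 - c`. -/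
def gens' (F : Fin s → R) (c m : ℕ) : Set R :=
  {M | M ∈ gens F c m ∧ s + 2 - c ≤ (supp F M).ncard}

end General

end StarConfig

end

/-! The hypothesis is used only in this form: each `F i` is a nonzerodivisor modulo the ideal of at
most `c` other members. Thus up to `c` of the forms behave like variables. Write `(F_T)` for the
ideal of a subset `T` of size `c`, and `F ^ a` for a monomial.

Being a nonzerodivisor modulo `(F_T)` passes to the powers of `(F_T)`, so the symbolic power is the
intersection of the `(F_T) ^ m` (`IsRegularFamily.mem_symbolicPower_iff`). This intersection is
generated by the monomials it visibly contains, those `F ^ b` with `m ≤ ∑ i ∈ T, b i` for every `T`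
(`mem_span_monomials_of_forall_mem_pow`). The minimal such exponents are exponents of elements of
`G` (`exists_isGenExponent_le`).

Degree in the family separates `I ^ m` from `G'`. The power `I ^ m` is generated by monomials of
degree at least `m (s + 1 - c)`, whereas elements of `G'` have smaller degree. The elements of `G`
outside `G'` are `m`-th powers of squarefree elements of `I`, so they vanish in the quotient.

Minimality comes from independence (`IsRegularFamily.mem_of_mul_monomial_mem`): if `r * F ^ a`, with
`F ^ a` in `G`, is a combination of other monomials of symbolic degree at least `m`, then `r` lies
in every ideal containing the family. Applied to the kernel of the constant coefficient map, this
shows that all relations among the generators have coefficients with zero constant term. Comparing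
ranks over `k` then gives the number of generators. -/

namespace StarConfig

universe u

/-! ### Regular families and nonzerodivisors modulo powers -/

section RegularFamily

variable {R : Type u} [CommRing R] {ι : Type*}

/-- Every `F i`, `i ∈ A`, is a nonzerodivisor modulo the ideal generated by any at most `c` other
members of the family `F` restricted to `A`. -/
def IsRegularFamily (F : ι → R) (A : Finset ι) (c : ℕ) : Prop :=
  ∀ i ∈ A, ∀ T ⊆ A, i ∉ T → T.card ≤ c →
    ∀ h, F i * h ∈ Ideal.span (F '' (T : Set ι)) → h ∈ Ideal.span (F '' (T : Set ι))

theorem IsRegularFamily.mono {F : ι → R} {A B : Finset ι} {c d : ℕ} (hF : IsRegularFamily F A c)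
    (hBA : B ⊆ A) (hdc : d ≤ c) : IsRegularFamily F B d :=
  fun i hi T hT hiT hc => hF i (hBA hi) T (hT.trans hBA) hiT (hc.trans hdc)

theorem mk_mem_map_iff (x f : R) (I : Ideal R) :
    Ideal.Quotient.mk (Ideal.span {x}) f ∈ I.map (Ideal.Quotient.mk (Ideal.span {x})) ↔
      f ∈ I ⊔ Ideal.span {x} := by
  rw [← Ideal.mem_comap, Ideal.comap_map_of_surjective _ Ideal.Quotient.mk_surjective,
    ← RingHom.ker_eq_comap_bot, Ideal.mk_ker]

theorem span_image_quotient (x : R) (F : ι → R) (T : Set ι) :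
    Ideal.span ((fun i => Ideal.Quotient.mk (Ideal.span {x}) (F i)) '' T) =
      (Ideal.span (F '' T)).map (Ideal.Quotient.mk (Ideal.span {x})) := by
  rw [Ideal.map_span, Set.image_image]

variable [DecidableEq ι]

theorem span_image_insert (F : ι → R) (y : ι) (T : Finset ι) :
    Ideal.span (F '' ((insert y T : Finset ι) : Set ι)) =
      Ideal.span (F '' (T : Set ι)) ⊔ Ideal.span {F y} := by
  rw [Finset.coe_insert, Set.image_insert_eq, Ideal.span_insert, sup_comm]

theorem IsRegularFamily.quotient {F : ι → R} {A : Finset ι} {c : ℕ}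
    (hF : IsRegularFamily F A (c + 1)) {y : ι} (hy : y ∈ A) :
    IsRegularFamily (fun i => Ideal.Quotient.mk (Ideal.span {F y}) (F i)) (A.erase y) c := by
  intro i hi T hT hiT hc h
  obtain ⟨h, rfl⟩ := Ideal.Quotient.mk_surjective h
  rw [← map_mul, span_image_quotient, mk_mem_map_iff, mk_mem_map_iff, ← span_image_insert]
  refine hF i (Finset.mem_of_mem_erase hi) _ ?_ ?_ ?_ h
  · exact Finset.insert_subset hy (hT.trans (Finset.erase_subset _ _))
  · simp [Finset.ne_of_mem_erase hi, hiT]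
  · exact (Finset.card_insert_le _ _).trans (by omega)

/-- On expanding a product of `n + 1` sums, each term either avoids `K` entirely or has a factor in
`K`. -/
theorem sup_pow_succ_le (I K : Ideal R) (n : ℕ) :
    (I ⊔ K) ^ (n + 1) ≤ I ^ (n + 1) ⊔ K * (I ⊔ K) ^ n := by
  induction n with
  | zero => simp
  | succ n ih =>
    rw [pow_succ' (I ⊔ K) (n + 1), Ideal.sup_mul]
    refine sup_le ?_ le_sup_right
    calc I * (I ⊔ K) ^ (n + 1) ≤ I * (I ^ (n + 1) ⊔ K * (I ⊔ K) ^ n) := Ideal.mul_mono_right ih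
      _ = I ^ (n + 1 + 1) ⊔ K * (I * (I ⊔ K) ^ n) := by
        rw [Ideal.mul_sup, ← pow_succ', mul_left_comm]
      _ ≤ _ := by
        rw [pow_succ' (I ⊔ K) n]
        gcongr
        exact le_sup_left

/-- If `y` is a nonzerodivisor modulo `I ^ (e + 1)`, then `(I, y) ^ (e + 1) : y = (I, y) ^ e`. -/
theorem mem_sup_span_pow {I : Ideal R} {y : R} {e : ℕ}
    (hy : ∀ h, y * h ∈ I ^ (e + 1) → h ∈ I ^ (e + 1)) {h : R}
    (hh : y * h ∈ (I ⊔ Ideal.span {y}) ^ (e + 1)) : h ∈ (I ⊔ Ideal.span {y}) ^ e := by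
  obtain ⟨p, hp, z, hz, hpz⟩ := Submodule.mem_sup.1 (sup_pow_succ_le _ _ _ hh)
  obtain ⟨q, hq, rfl⟩ := Ideal.mem_span_singleton_mul.1 hz
  have h1 : h - q ∈ I ^ (e + 1) := hy _ (by
    rw [mul_sub, ← hpz, add_sub_cancel_right]; exact hp)
  have h2 : h - q ∈ (I ⊔ Ideal.span {y}) ^ e :=
    Ideal.pow_le_pow_right e.le_succ (Ideal.pow_right_mono le_sup_left _ h1)
  simpa using add_mem h2 hq

/-- A nonzerodivisor modulo a regular sequence stays one modulo the powers of its ideal. The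
induction on `T` passes to `R / (F y)`, so the ring has to vary. -/
theorem mem_span_pow_of_mul_mem (T : Finset ι) : ∀ {R : Type u} [CommRing R] {F : ι → R},
    IsRegularFamily F T T.card → ∀ {x : R},
    (∀ h, x * h ∈ Ideal.span (F '' (T : Set ι)) → h ∈ Ideal.span (F '' (T : Set ι))) →
    ∀ {e : ℕ} {h : R}, x * h ∈ Ideal.span (F '' (T : Set ι)) ^ e →
      h ∈ Ideal.span (F '' (T : Set ι)) ^ e := by
  induction T using Finset.induction_on with
  | empty =>
    intro R _ F hF x hx e h
    cases e with
    | zero => simp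
    | succ e => simpa using hx h
  | insert y T hyT ih =>
    intro R _ F hF x hx e h hh
    -- The induction hypothesis, applied to `F y` itself in `R`, lets `F y` be cancelled at the cost
    -- of one power.
    have hQ : ∀ {e : ℕ} {z : R},
        F y * z ∈ Ideal.span (F '' ((insert y T : Finset ι) : Set ι)) ^ (e + 1) →
        z ∈ Ideal.span (F '' ((insert y T : Finset ι) : Set ι)) ^ e := by
      intro e z hz
      rw [span_image_insert] at hz ⊢
      refine mem_sup_span_pow (fun w hw => ih (hF.mono (Finset.subset_insert _ _) ?_) ?_ hw) hz
      · exact Finset.card_le_card (Finset.subset_insert _ _)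
      · exact hF y (Finset.mem_insert_self _ _) T (Finset.subset_insert _ _) hyT
          (Finset.card_le_card (Finset.subset_insert _ _))
    induction e generalizing h with
    | zero => simp
    | succ e ihe =>
      have hF' : IsRegularFamily (fun i => Ideal.Quotient.mk (Ideal.span {F y}) (F i)) T T.card := by
        rw [Finset.card_insert_of_notMem hyT] at hF
        have := hF.quotient (Finset.mem_insert_self y T)
        rwa [Finset.erase_insert hyT] at this
      have h1 : Ideal.Quotient.mk (Ideal.span {F y}) h ∈
          Ideal.span ((fun i => Ideal.Quotient.mk (Ideal.span {F y}) (F i)) '' (T : Set ι)) ^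
            (e + 1) := by
        refine ih hF' (x := Ideal.Quotient.mk (Ideal.span {F y}) x) ?_ ?_
        · intro z
          obtain ⟨z, rfl⟩ := Ideal.Quotient.mk_surjective z
          rw [← map_mul, span_image_quotient, mk_mem_map_iff, mk_mem_map_iff, ← span_image_insert]
          exact hx z
        · rw [← map_mul, span_image_quotient, ← Ideal.map_pow, mk_mem_map_iff]
          rw [span_image_insert] at hh
          refine (sup_pow_succ_le _ _ _).trans (sup_le_sup_left Ideal.mul_le_left _) hh
      rw [span_image_quotient, ← Ideal.map_pow, mk_mem_map_iff] at h1
      -- Lifting from the quotient gives `h = p + w * F y` with `p` already in the power. It remains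
      -- to place `w` one power lower, by induction on the exponent.
      obtain ⟨p, hp, z, hz, rfl⟩ := Submodule.mem_sup.1 h1
      obtain ⟨w, rfl⟩ := Ideal.mem_span_singleton'.1 hz
      have hp' : p ∈ Ideal.span (F '' ((insert y T : Finset ι) : Set ι)) ^ (e + 1) := by
        rw [span_image_insert]
        exact Ideal.pow_right_mono le_sup_left _ hp
      refine add_mem hp' ?_
      have h2 : F y * (x * w) ∈ Ideal.span (F '' ((insert y T : Finset ι) : Set ι)) ^ (e + 1) := by
        have := sub_mem hh (Ideal.mul_mem_left _ x hp')
        convert this using 1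
        ring
      rw [mul_comm, pow_succ']
      exact Ideal.mul_mem_mul (Ideal.subset_span ⟨y, by simp, rfl⟩) (ihe (hQ h2))

theorem IsRegularFamily.mem_pow_of_mul_mem {F : ι → R} {A T : Finset ι} {c : ℕ}
    (hF : IsRegularFamily F A c) (hT : T ⊆ A) (hTc : T.card ≤ c) {x : R}
    (hx : ∀ h, x * h ∈ Ideal.span (F '' (T : Set ι)) → h ∈ Ideal.span (F '' (T : Set ι)))
    {e : ℕ} {h : R} (hh : x * h ∈ Ideal.span (F '' (T : Set ι)) ^ e) :
    h ∈ Ideal.span (F '' (T : Set ι)) ^ e :=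
  mem_span_pow_of_mul_mem T (hF.mono hT hTc) hx hh

theorem IsRegularFamily.mem_pow_of_mul_mem_of_notMem {F : ι → R} {A T : Finset ι} {c : ℕ}
    (hF : IsRegularFamily F A c) (hT : T ⊆ A) (hTc : T.card ≤ c) {i : ι} (hi : i ∈ A)
    (hiT : i ∉ T) {e : ℕ} {h : R} (hh : F i * h ∈ Ideal.span (F '' (T : Set ι)) ^ e) :
    h ∈ Ideal.span (F '' (T : Set ι)) ^ e :=
  hF.mem_pow_of_mul_mem hT hTc (hF i hi T hT hiT hTc) hh

theorem IsRegularFamily.mem_pow_pred_of_mul_mem {F : ι → R} {A T : Finset ι} {c : ℕ}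
    (hF : IsRegularFamily F A c) (hT : T ⊆ A) (hTc : T.card ≤ c) {i : ι}
    (hiT : i ∈ T) {e : ℕ} {h : R} (hh : F i * h ∈ Ideal.span (F '' (T : Set ι)) ^ e) :
    h ∈ Ideal.span (F '' (T : Set ι)) ^ (e - 1) := by
  cases e with
  | zero => simp
  | succ e =>
    rw [← Finset.insert_erase hiT, span_image_insert] at hh ⊢
    refine mem_sup_span_pow (fun w hw => ?_) hh
    exact hF.mem_pow_of_mul_mem_of_notMem ((Finset.erase_subset _ _).trans hT)
      ((Finset.card_le_card (Finset.erase_subset _ _)).trans hTc) (hT hiT)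
      (Finset.notMem_erase _ _) hw

theorem IsRegularFamily.of_prod_mul_mem {F : ι → R} {A T : Finset ι} {c : ℕ}
    (hF : IsRegularFamily F A c) (hT : T ⊆ A) (hTc : T.card ≤ c) {U : Finset ι} (hU : U ⊆ A)
    (hUT : Disjoint U T) (a : ι → ℕ) {h : R}
    (hh : (∏ i ∈ U, F i ^ a i) * h ∈ Ideal.span (F '' (T : Set ι))) :
    h ∈ Ideal.span (F '' (T : Set ι)) := by
  have hpow : ∀ i ∈ U, ∀ n : ℕ, ∀ z, F i ^ n * z ∈ Ideal.span (F '' (T : Set ι)) →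
      z ∈ Ideal.span (F '' (T : Set ι)) := by
    intro i hi n
    induction n with
    | zero => simp
    | succ n ih =>
      intro z hz
      rw [pow_succ, mul_assoc] at hz
      exact hF i (hU hi) T hT (Finset.disjoint_left.1 hUT hi) hTc _ (ih _ hz)
  clear hU hUT
  induction U using Finset.induction_on generalizing h with
  | empty => simpa using hh
  | insert j U hj ih =>
    rw [Finset.prod_insert hj, mul_assoc] at hh
    exact ih (hpow j (Finset.mem_insert_self _ _) _ _ hh)
      fun i hi => hpow i (Finset.mem_insert_of_mem hi)

end RegularFamily

/-! ### Intersections of powers are generated by monomials -/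

section Generation

variable {ι : Type*} [DecidableEq ι]

theorem prod_pow_mem_span_pow {R : Type*} [CommRing R] (F : ι → R) {A T : Finset ι} (hT : T ⊆ A)
    (a : ι → ℕ) {e : ℕ} (he : e ≤ ∑ i ∈ T, a i) :
    ∏ i ∈ A, F i ^ a i ∈ Ideal.span (F '' (T : Set ι)) ^ e := by
  rw [← Finset.prod_sdiff hT]
  refine Ideal.mul_mem_left _ _ (Ideal.pow_le_pow_right he ?_)
  rw [← Finset.prod_pow_eq_pow_sum]
  exact Ideal.prod_mem_prod fun i hi => Ideal.pow_mem_pow (Ideal.subset_span (Set.mem_image_of_mem F hi)) _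

/-- An intersection of powers `(F_T) ^ (m - v(T))`, where `T` runs through the subsets of size `c`,
is generated by the monomials it contains. -/
theorem mem_span_monomials_of_forall_mem_pow (c : ℕ) : ∀ {R : Type u} [CommRing R] {F : ι → R}
    {A : Finset ι} {m : ℕ} (v : ι → ℕ), IsRegularFamily F A c → ∀ {f : R},
    (∀ T ⊆ A, T.card = c → f ∈ Ideal.span (F '' (T : Set ι)) ^ (m - ∑ i ∈ T, v i)) →
    f ∈ Ideal.span {g | ∃ a : ι → ℕ, (∀ T ⊆ A, T.card = c → m ≤ ∑ i ∈ T, (a i + v i)) ∧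
      g = ∏ i ∈ A, F i ^ a i} := by
  induction c with
  | zero =>
    intro R _ F A m v _ f hf
    have h0 := hf ∅ (Finset.empty_subset _) rfl
    rcases Nat.eq_zero_or_pos m with rfl | hm
    · have h1 : (1 : R) ∈ Ideal.span {g | ∃ a : ι → ℕ,
          (∀ T ⊆ A, T.card = 0 → 0 ≤ ∑ i ∈ T, (a i + v i)) ∧ g = ∏ i ∈ A, F i ^ a i} :=
        Ideal.subset_span ⟨0, by simp, by simp⟩
      exact (Ideal.eq_top_iff_one _).2 h1 ▸ Submodule.mem_top
    · rw [Finset.coe_empty, Set.image_empty, Ideal.span_empty, Finset.sum_empty, Nat.sub_zero,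
        Ideal.zero_eq_bot.symm, zero_pow hm.ne'] at h0
      rw [(Ideal.mem_bot).1 h0]
      exact zero_mem _
  | succ c ih =>
    intro R _ F A m v hF f hf
    -- The shift `v` records the factors already divided out of the original element; each division
    -- by some `F i` lowers this sum.
    induction hN : ∑ i ∈ A, (m - v i) using Nat.strong_induction_on generalizing v f with
    | _ N ihN =>
    by_cases hv : ∀ i ∈ A, m ≤ v i
    · have h1 : (1 : R) ∈ Ideal.span {g | ∃ a : ι → ℕ,
          (∀ T ⊆ A, T.card = c + 1 → m ≤ ∑ i ∈ T, (a i + v i)) ∧ g = ∏ i ∈ A, F i ^ a i} := by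
        refine Ideal.subset_span ⟨0, fun T hT hTc => ?_, by simp⟩
        obtain ⟨i, hi⟩ := Finset.card_pos.1 (by omega : 0 < T.card)
        exact (hv i (hT hi)).trans
          (by simpa using Finset.single_le_sum (f := v) (fun _ _ => Nat.zero_le _) hi)
      exact (Ideal.eq_top_iff_one _).2 h1 ▸ Submodule.mem_top
    · push Not at hv
      obtain ⟨j, hjA, hj⟩ := hv
      -- Minimality of `v i` is what makes lifts of monomials from `R / (F i)` admissible in `R`:
      -- for `T` without `i`, one drops some `l ∈ T` and uses `v i ≤ v l`.
      obtain ⟨i, hiA, hmin⟩ := A.exists_min_image v ⟨j, hjA⟩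
      have hi : v i < m := (hmin j hjA).trans_lt hj
      -- the reduction modulo `F i`
      have hbar : Ideal.Quotient.mk (Ideal.span {F i}) f ∈ Ideal.span {g | ∃ a : ι → ℕ,
          (∀ T ⊆ A.erase i, T.card = c → m - v i ≤ ∑ k ∈ T, (a k + v k)) ∧
          g = ∏ k ∈ A.erase i, Ideal.Quotient.mk (Ideal.span {F i}) (F k) ^ a k} := by
        refine ih v (hF.quotient hiA) fun T hT hTc => ?_
        have hiT : i ∉ T := fun h => Finset.notMem_erase i A (hT h)
        have := hf (insert i T) (Finset.insert_subset hiA (hT.trans (Finset.erase_subset _ _)))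
          (by rw [Finset.card_insert_of_notMem hiT, hTc])
        rw [Finset.sum_insert hiT, ← Nat.sub_sub, span_image_insert] at this
        rw [span_image_quotient, ← Ideal.map_pow, mk_mem_map_iff]
        generalize m - v i - ∑ k ∈ T, v k = e at this ⊢
        rcases e with - | e
        · simp
        · exact (sup_pow_succ_le _ _ _).trans (sup_le_sup_left Ideal.mul_le_left _) this
      have hset : {g | ∃ a : ι → ℕ,
          (∀ T ⊆ A.erase i, T.card = c → m - v i ≤ ∑ k ∈ T, (a k + v k)) ∧
          g = ∏ k ∈ A.erase i, Ideal.Quotient.mk (Ideal.span {F i}) (F k) ^ a k} =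
          Ideal.Quotient.mk (Ideal.span {F i}) '' {g | ∃ a : ι → ℕ,
          (∀ T ⊆ A.erase i, T.card = c → m - v i ≤ ∑ k ∈ T, (a k + v k)) ∧
          g = ∏ k ∈ A.erase i, F k ^ a k} := by
        ext g
        constructor
        · rintro ⟨a, ha, rfl⟩
          exact ⟨_, ⟨a, ha, rfl⟩, by simp⟩
        · rintro ⟨_, ⟨a, ha, rfl⟩, rfl⟩
          exact ⟨a, ha, by simp⟩
      rw [hset, ← Ideal.map_span, mk_mem_map_iff] at hbar
      obtain ⟨g, hg, z, hz, rfl⟩ := Submodule.mem_sup.1 hbar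
      obtain ⟨h, rfl⟩ := Ideal.mem_span_singleton'.1 hz
      set J := Ideal.span {g | ∃ a : ι → ℕ,
        (∀ T ⊆ A, T.card = c + 1 → m ≤ ∑ i ∈ T, (a i + v i)) ∧ g = ∏ i ∈ A, F i ^ a i} with hJ
      have hJmem : ∀ x ∈ J, ∀ T ⊆ A, T.card = c + 1 →
          x ∈ Ideal.span (F '' (T : Set ι)) ^ (m - ∑ i ∈ T, v i) := by
        intro x hx T hT hTc
        refine Ideal.span_le.2 ?_ hx
        rintro _ ⟨a, ha, rfl⟩
        refine prod_pow_mem_span_pow F hT a ?_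
        have := ha T hT hTc
        rw [Finset.sum_add_distrib] at this
        omega
      have hgJ : g ∈ J := by
        refine Ideal.span_le.2 ?_ hg
        rintro _ ⟨a, ha, rfl⟩
        refine Ideal.subset_span ⟨Function.update a i 0, fun T hT hTc => ?_, ?_⟩
        · by_cases hiT : i ∈ T
          · have h1 := ha (T.erase i) (Finset.erase_subset_erase i hT)
              (by rw [Finset.card_erase_of_mem hiT, hTc]; rfl)
            rw [← Finset.add_sum_erase _ _ hiT]
            have : ∑ k ∈ T.erase i, (Function.update a i 0 k + v k) =
                ∑ k ∈ T.erase i, (a k + v k) :=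
              Finset.sum_congr rfl fun k hk => by
                rw [Function.update_of_ne (Finset.ne_of_mem_erase hk)]
            rw [this, Function.update_self]
            omega
          · obtain ⟨l, hl⟩ := Finset.card_pos.1 (by omega : 0 < T.card)
            have h1 := ha (T.erase l)
              (fun k hk => Finset.mem_erase.2 ⟨fun h => hiT (h ▸ Finset.mem_of_mem_erase hk),
                hT (Finset.mem_of_mem_erase hk)⟩)
              (by rw [Finset.card_erase_of_mem hl, hTc]; rfl)
            have : ∑ k ∈ T, (Function.update a i 0 k + v k) = ∑ k ∈ T, (a k + v k) :=
              Finset.sum_congr rfl fun k hk => by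
                rw [Function.update_of_ne (fun h : k = i => hiT (h ▸ hk))]
            rw [this, ← Finset.add_sum_erase _ _ hl]
            have := hmin l (hT hl)
            omega
        · rw [← Finset.mul_prod_erase _ _ hiA, Function.update_self, pow_zero, one_mul]
          exact Finset.prod_congr rfl fun k hk => by
            rw [Function.update_of_ne (Finset.ne_of_mem_erase hk)]
      refine add_mem hgJ ?_
      have hFh : ∀ T ⊆ A, T.card = c + 1 →
          F i * h ∈ Ideal.span (F '' (T : Set ι)) ^ (m - ∑ i ∈ T, v i) := by
        intro T hT hTc
        have := sub_mem (hf T hT hTc) (hJmem g hgJ T hT hTc)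
        rwa [add_sub_cancel_left, mul_comm] at this
      -- Cancelling `F i` loses one power exactly for those `T` that contain `i`, which is the
      -- effect of raising `v i` by one.
      have hh := ihN (∑ k ∈ A, (m - (v + Pi.single i 1 : ι → ℕ) k)) ?_ (v + Pi.single i 1) (f := h) ?_ rfl
      · have hle : Ideal.span {g | ∃ a : ι → ℕ,
            (∀ T ⊆ A, T.card = c + 1 → m ≤ ∑ k ∈ T, (a k + (v + Pi.single i 1 : ι → ℕ) k)) ∧
            g = ∏ k ∈ A, F k ^ a k} ≤ Submodule.comap (LinearMap.mulLeft R (F i)) J := by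
          refine Ideal.span_le.2 ?_
          rintro _ ⟨a, ha, rfl⟩
          refine Ideal.subset_span ⟨a + Pi.single i 1, fun T hT hTc => ?_, ?_⟩
          · refine (ha T hT hTc).trans (Finset.sum_le_sum fun k _ => ?_)
            simp only [Pi.add_apply]
            omega
          · simp only [LinearMap.mulLeft_apply, Pi.add_apply, pow_add, Finset.prod_mul_distrib]
            rw [mul_comm]
            congr 1
            rw [Finset.prod_eq_single_of_mem i hiA]
            · simp
            · intro k _ hk
              simp [hk]
        rw [mul_comm]
        exact hle hh
      · rw [← hN]
        refine Finset.sum_lt_sum (fun k _ => ?_) ⟨i, hiA, ?_⟩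
        · simp only [Pi.add_apply]
          omega
        · simp only [Pi.add_apply, Pi.single_eq_same]
          omega
      · intro T hT hTc
        simp only [Pi.add_apply, Finset.sum_add_distrib]
        by_cases hiT : i ∈ T
        · rw [Finset.sum_pi_single', if_pos hiT, ← Nat.sub_sub]
          exact hF.mem_pow_pred_of_mul_mem hT hTc.le hiT (hFh T hT hTc)
        · rw [Finset.sum_pi_single', if_neg hiT, Nat.add_zero]
          exact hF.mem_pow_of_mul_mem_of_notMem hT hTc.le hiA hiT (hFh T hT hTc)

end Generation

/-! ### Independence of monomials in a regular sequence -/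

section Independence

variable {R : Type u} [CommRing R] {ι : Type*} [DecidableEq ι]

theorem IsRegularFamily.mem_span_of_mem_pow {F : ι → R} {T : Finset ι} {c : ℕ}
    (hF : IsRegularFamily F T c) (hTc : T.card ≤ c) {m : ℕ} {f : R}
    (hf : f ∈ Ideal.span (F '' (T : Set ι)) ^ m) :
    f ∈ Ideal.span {g | ∃ u : ι → ℕ, m ≤ ∑ i ∈ T, u i ∧ g = ∏ i ∈ T, F i ^ u i} := by
  have := mem_span_monomials_of_forall_mem_pow T.card (f := f) (m := m) 0
    (hF.mono subset_rfl hTc) (fun U hU hUc => by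
      rw [Finset.eq_of_subset_of_card_le hU hUc.ge]; simpa using hf)
  refine Ideal.span_mono ?_ this
  rintro _ ⟨a, ha, rfl⟩
  exact ⟨a, by simpa using ha T subset_rfl rfl, rfl⟩

/-- The ideal generated by the monomials in `F_T` which have at least the degree of `F_T ^ a` but
are different from it. -/
def otherMonomials (F : ι → R) (T : Finset ι) (a : ι → ℕ) : Ideal R :=
  Ideal.span {g | ∃ u : ι → ℕ, ∑ i ∈ T, a i ≤ ∑ i ∈ T, u i ∧ (∃ i ∈ T, u i ≠ a i) ∧
    g = ∏ i ∈ T, F i ^ u i}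

theorem prod_pow_eq_mul_update (F : ι → R) {T : Finset ι} {i : ι} (hi : i ∈ T) (a : ι → ℕ)
    (ha : 0 < a i) :
    ∏ k ∈ T, F k ^ a k = F i * ∏ k ∈ T, F k ^ Function.update a i (a i - 1) k := by
  rw [← Finset.mul_prod_erase _ _ hi, ← Finset.mul_prod_erase _ _ hi, Function.update_self,
    ← mul_assoc, mul_pow_sub_one ha.ne']
  congr 1
  exact Finset.prod_congr rfl fun k hk => by
    rw [Function.update_of_ne (Finset.ne_of_mem_erase hk)]

theorem sum_eq_update_add_one {T : Finset ι} {i : ι} (hi : i ∈ T) (a : ι → ℕ) (ha : 0 < a i) :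
    ∑ k ∈ T, a k = ∑ k ∈ T, Function.update a i (a i - 1) k + 1 := by
  rw [← Finset.add_sum_erase _ _ hi, ← Finset.add_sum_erase _ _ hi, Function.update_self]
  have : ∑ k ∈ T.erase i, Function.update a i (a i - 1) k = ∑ k ∈ T.erase i, a k :=
    Finset.sum_congr rfl fun k hk => by
      rw [Function.update_of_ne (Finset.ne_of_mem_erase hk)]
  omega

/-- Induction on the degree of `a` on `T`. If `a i > 0`, the competing monomials not divisible by `F
i` lie in a power of `(F_{T \ i})`, modulo which `F i` can be cancelled; the divisible ones become
competitors of `a` lowered at `i`. -/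
theorem IsRegularFamily.mem_of_mul_mem_otherMonomials {F : ι → R} {T : Finset ι} {c : ℕ}
    (hF : IsRegularFamily F T c) (hTc : T.card ≤ c) (a : ι → ℕ) {r : R}
    (hr : r * ∏ i ∈ T, F i ^ a i ∈ otherMonomials F T a) :
    r ∈ Ideal.span (F '' (T : Set ι)) := by
  induction hn : ∑ i ∈ T, a i generalizing a with
  | zero =>
    have h0 : ∀ i ∈ T, a i = 0 := by simpa using hn
    rw [Finset.prod_congr rfl fun i hi => by rw [h0 i hi, pow_zero], Finset.prod_const_one,
      mul_one] at hr
    refine Ideal.span_le.2 ?_ hr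
    rintro _ ⟨u, -, ⟨i, hi, hu⟩, rfl⟩
    rw [h0 i hi] at hu
    have := prod_pow_mem_span_pow F (subset_refl T) u (e := 1)
      ((Nat.one_le_iff_ne_zero.2 hu).trans
        (Finset.single_le_sum (f := u) (fun _ _ => Nat.zero_le _) hi))
    simpa using this
  | succ n ih =>
    obtain ⟨i, hi, hai⟩ : ∃ i ∈ T, 0 < a i := by
      by_contra! h
      have : ∑ i ∈ T, a i = 0 := Finset.sum_eq_zero fun i hi => Nat.le_zero.1 (h i hi)
      omega
    set a' := Function.update a i (a i - 1) with ha'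
    have hsum : ∑ k ∈ T, a k = ∑ k ∈ T, a' k + 1 := sum_eq_update_add_one hi a hai
    have hle : otherMonomials F T a ≤ Ideal.span (F '' ((T.erase i : Finset ι) : Set ι)) ^ (n + 1) ⊔
        Ideal.span {F i} * otherMonomials F T a' := by
      refine Ideal.span_le.2 ?_
      rintro _ ⟨u, hu, ⟨k, hk, hku⟩, rfl⟩
      rcases Nat.eq_zero_or_pos (u i) with h0 | hpos
      · refine Ideal.mem_sup_left (prod_pow_mem_span_pow F (Finset.erase_subset i T) u ?_)
        have := Finset.add_sum_erase _ u hi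
        omega
      · refine Ideal.mem_sup_right ?_
        rw [prod_pow_eq_mul_update F hi u hpos]
        refine Ideal.mul_mem_mul (Ideal.mem_span_singleton_self _)
          (Ideal.subset_span ⟨_, ?_, ⟨k, hk, ?_⟩, rfl⟩)
        · have := sum_eq_update_add_one hi u hpos
          omega
        · rw [ha']
          by_cases hki : k = i
          · subst hki
            rw [Function.update_self, Function.update_self]
            omega
          · rwa [Function.update_of_ne hki, Function.update_of_ne hki]
    obtain ⟨p, hp, z, hz, hpz⟩ := Submodule.mem_sup.1 (hle hr)
    obtain ⟨q, hq, rfl⟩ := Ideal.mem_span_singleton_mul.1 hz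
    have h1 : F i * (r * ∏ k ∈ T, F k ^ a' k - q) ∈
        Ideal.span (F '' ((T.erase i : Finset ι) : Set ι)) ^ (n + 1) := by
      rw [prod_pow_eq_mul_update F hi a hai] at hpz
      convert hp using 1
      linear_combination -hpz
    have h2 := hF.mem_pow_of_mul_mem_of_notMem (Finset.erase_subset i T)
      ((Finset.card_le_card (Finset.erase_subset i T)).trans hTc) hi (Finset.notMem_erase i T) h1
    have h3 : r * ∏ k ∈ T, F k ^ a' k - q ∈ Ideal.span (F '' (T : Set ι)) ^ (n + 1) :=
      Ideal.pow_right_mono (Ideal.span_mono (Set.image_mono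
        (Finset.coe_subset.2 (Finset.erase_subset i T)))) _ h2
    -- The error from cancelling has degree at least `n + 1`, more than the degree `n` of `a'`, so
    -- its monomials automatically differ from that of `a'`.
    have h4 : Ideal.span {g | ∃ u : ι → ℕ, n + 1 ≤ ∑ i ∈ T, u i ∧ g = ∏ i ∈ T, F i ^ u i} ≤
        otherMonomials F T a' := by
      refine Ideal.span_mono ?_
      rintro _ ⟨u, hu, rfl⟩
      refine ⟨u, by omega, ?_, rfl⟩
      by_contra! h
      have : ∑ k ∈ T, u k = ∑ k ∈ T, a' k := Finset.sum_congr rfl h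
      omega
    refine ih a' ?_ (by omega)
    simpa using add_mem (h4 (hF.mem_span_of_mem_pow hTc h3)) hq

end Independence

/-! ### Combinatorics of exponents: minimal elements and exchange -/

section Exponents

variable {ι : Type*} [DecidableEq ι]

/-- The exponents of the monomials of symbolic degree at least `m`. -/
def SdegGE (c m : ℕ) (b : ι → ℕ) : Prop :=
  ∀ T : Finset ι, T.card = c → m ≤ ∑ i ∈ T, b i

/-- The exponents of the elements of `G_{c,(m)}`. -/
def IsGenExponent (c m : ℕ) (a : ι → ℕ) : Prop :=
  ∃ T : Finset ι, T.card = c ∧ ∑ i ∈ T, a i = m ∧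
    ∃ j ∈ T, (∀ i, a i ≤ a j) ∧ ∀ i ∉ T, a i = a j

/-- Exchanging elements of `T` for elements outside it replaces values by the maximal value, so `T`
minimises the sum among sets of its size. -/
theorem IsGenExponent.sdegGE {c m : ℕ} {a : ι → ℕ} (ha : IsGenExponent c m a) :
    SdegGE c m a := by
  obtain ⟨T, hT, rfl, j, hj, hle, heq⟩ := ha
  intro U hU
  rw [← Finset.sum_inter_add_sum_sdiff T U, ← Finset.sum_inter_add_sum_sdiff U T, Finset.inter_comm]
  refine Nat.add_le_add_left ?_ _
  have h1 : ∑ i ∈ U \ T, a i = (U \ T).card * a j := by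
    rw [Finset.sum_congr rfl fun i hi => heq i (Finset.mem_sdiff.1 hi).2]
    simp
  have h2 : ∑ i ∈ T \ U, a i ≤ (T \ U).card * a j := by
    simpa using Finset.sum_le_card_nsmul _ _ _ fun i _ => hle i
  rw [h1, Finset.card_sdiff_comm (hU.trans hT.symm)]
  exact h2

variable [Fintype ι]

/-- Take a minimal `a` below `b` and a maximal entry `a j`. Lowering it violates the condition at
some `T`, which therefore contains `j` and has sum exactly `m`; exchanging `j` for `i ∉ T` then
forces `a i = a j`. -/
theorem exists_isGenExponent_le {c m : ℕ} (hc : c ≤ Fintype.card ι) (hm : 1 ≤ m) {b : ι → ℕ}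
    (hb : SdegGE c m b) : ∃ a ≤ b, IsGenExponent c m a := by
  obtain ⟨a, hab, hmin⟩ := exists_minimal_le_of_wellFoundedLT (SdegGE c m) b hb
  refine ⟨a, hab, ?_⟩
  obtain ⟨U, -, hU⟩ := Finset.exists_subset_card_eq (s := Finset.univ) (n := c) (by simpa using hc)
  obtain ⟨l, hl⟩ : ∃ l, 0 < a l := by
    by_contra! h
    have h1 := hmin.1 U hU
    have h2 : ∑ i ∈ U, a i = 0 := Finset.sum_eq_zero fun i _ => Nat.le_zero.1 (h i)
    omega
  obtain ⟨j, -, hj⟩ := Finset.univ.exists_max_image a ⟨l, Finset.mem_univ l⟩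
  have hpos : 0 < a j := hl.trans_le (hj l (Finset.mem_univ l))
  have hnot : ¬ SdegGE c m (Function.update a j (a j - 1)) := by
    intro h
    have h1 : Function.update a j (a j - 1) ≤ a :=
      update_le_self_iff.2 (Nat.sub_le _ _)
    have h2 : a j ≤ Function.update a j (a j - 1) j := hmin.2 h h1 j
    rw [Function.update_self] at h2
    omega
  simp only [SdegGE, not_forall, not_le] at hnot
  obtain ⟨T, hT, hlt⟩ := hnot
  have hge := hmin.1 T hT
  have hjT : j ∈ T := by
    by_contra hjT
    rw [Finset.sum_congr rfl fun k hk =>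
      Function.update_of_ne (fun h : k = j => hjT (h ▸ hk)) _ _] at hlt
    omega
  have hsum := sum_eq_update_add_one hjT a hpos
  refine ⟨T, hT, by omega, j, hjT, fun i => hj i (Finset.mem_univ i), fun i hi => ?_⟩
  refine le_antisymm (hj i (Finset.mem_univ i)) ?_
  have hi' : i ∉ T.erase j := fun h => hi (Finset.mem_of_mem_erase h)
  have h1 := hmin.1 (insert i (T.erase j)) (by
    rw [Finset.card_insert_of_notMem hi', Finset.card_erase_of_mem hjT]
    have := Finset.card_pos.2 ⟨j, hjT⟩
    omega)
  rw [Finset.sum_insert hi'] at h1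
  have h2 := Finset.add_sum_erase _ a hjT
  omega

/-- The monomials `F ^ a`, `a` the exponent of an element of `G_{c,(m)}`, are independent modulo
any ideal that contains the family. -/
theorem IsRegularFamily.mem_of_mul_monomial_mem {R : Type u} [CommRing R] {F : ι → R} {c m : ℕ}
    (hF : IsRegularFamily F Finset.univ c) {I : Ideal R} (hI : ∀ i, F i ∈ I) {a : ι → ℕ}
    (ha : IsGenExponent c m a) {r : R}
    (hr : r * ∏ i, F i ^ a i ∈
      Ideal.span {g | ∃ b : ι → ℕ, b ≠ a ∧ SdegGE c m b ∧ g = ∏ i, F i ^ b i}) : r ∈ I := by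
  obtain ⟨T, hT, rfl, j, hj, -, heq⟩ := ha
  have hle : Ideal.span {g | ∃ b : ι → ℕ, b ≠ a ∧ SdegGE c (∑ i ∈ T, a i) b ∧
      g = ∏ i, F i ^ b i} ≤ Ideal.span {∏ i, F i ^ a i} * I ⊔ otherMonomials F T a := by
    refine Ideal.span_le.2 ?_
    rintro _ ⟨b, hba, hb, rfl⟩
    -- If `b` differs from `a` on `T`, its `T`-part is a competitor in the regular sequence `F_T`.
    -- Otherwise, exchanging `j` for each `i ∉ T` gives `a ≤ b`, and `F ^ b` is a multiple of `F ^
    -- a` by an element of `I`.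
    by_cases hbT : ∃ i ∈ T, b i ≠ a i
    · refine Ideal.mem_sup_right ?_
      rw [← Finset.prod_sdiff (Finset.subset_univ T)]
      exact Ideal.mul_mem_left _ _ (Ideal.subset_span ⟨b, hb T hT, hbT, rfl⟩)
    · push Not at hbT
      refine Ideal.mem_sup_left ?_
      have hab : a ≤ b := by
        intro i
        change a i ≤ b i
        by_cases hi : i ∈ T
        · exact (hbT i hi).ge
        · have hi' : i ∉ T.erase j := fun h => hi (Finset.mem_of_mem_erase h)
          have h1 := hb (insert i (T.erase j)) (by
            rw [Finset.card_insert_of_notMem hi', Finset.card_erase_of_mem hj]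
            have := Finset.card_pos.2 ⟨j, hj⟩
            omega)
          have h2 := Finset.add_sum_erase _ a hj
          have h4 : ∑ k ∈ T.erase j, b k = ∑ k ∈ T.erase j, a k :=
            Finset.sum_congr rfl fun k hk => hbT k (Finset.mem_of_mem_erase hk)
          rw [Finset.sum_insert hi'] at h1
          have h3 := heq i hi
          omega
      obtain ⟨i, hi⟩ := Function.ne_iff.1 hba
      have hprod : ∏ k, F k ^ b k = (∏ k, F k ^ a k) * ∏ k, F k ^ (b k - a k) := by
        rw [← Finset.prod_mul_distrib]
        exact Finset.prod_congr rfl fun k _ => by rw [← pow_add, Nat.add_sub_cancel' (hab k)]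
      rw [hprod]
      refine Ideal.mul_mem_mul (Ideal.mem_span_singleton_self _) ?_
      have hab' : a i ≤ b i := hab i
      exact Ideal.mem_of_dvd _ ((dvd_pow_self _ (by omega)).trans
        (Finset.dvd_prod_of_mem (fun k => F k ^ (b k - a k)) (Finset.mem_univ i))) (hI i)
  obtain ⟨z, hz, q, hq, hzq⟩ := Submodule.mem_sup.1 (hle hr)
  obtain ⟨μ, hμ, rfl⟩ := Ideal.mem_span_singleton_mul.1 hz
  have h1 : (∏ i ∈ Finset.univ \ T, F i ^ a i) * (r - μ) ∈ Ideal.span (F '' (T : Set ι)) := by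
    refine (hF.mono (Finset.subset_univ T) le_rfl).mem_of_mul_mem_otherMonomials hT.le a ?_
    rw [← Finset.prod_sdiff (Finset.subset_univ T)] at hzq
    convert hq using 1
    linear_combination -hzq
  have h2 := hF.of_prod_mul_mem (Finset.subset_univ T) hT.le (Finset.subset_univ _)
    Finset.sdiff_disjoint a h1
  have h3 : Ideal.span (F '' (T : Set ι)) ≤ I := by
    refine Ideal.span_le.2 ?_
    rintro _ ⟨i, -, rfl⟩
    exact hI i
  simpa using add_mem (h3 h2) hμ

end Exponents

/-! ### Associated primes and symbolic powers of the star ideal -/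

section SymbolicPower

variable {R : Type u} [CommRing R] {s c : ℕ} {F : Fin s → R}

theorem mem_starIdeal_iff {f : R} :
    f ∈ starIdeal F c ↔
      ∀ T : Finset (Fin s), T.card = c → f ∈ Ideal.span (F '' (T : Set (Fin s))) := by
  simp [starIdeal]

theorem starIdeal_le {T : Finset (Fin s)} (hT : T.card = c) :
    starIdeal F c ≤ Ideal.span (F '' (T : Set (Fin s))) :=
  fun _ hf => mem_starIdeal_iff.1 hf T hT

/-- The product of the `F i` with `i ∉ T` multiplies `(F_T)` into the star ideal. -/
theorem prod_compl_mul_mem_starIdeal {T : Finset (Fin s)} (hT : T.card = c) {f : R}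
    (hf : f ∈ Ideal.span (F '' (T : Set (Fin s)))) :
    (∏ i ∈ Finset.univ \ T, F i ^ 1) * f ∈ starIdeal F c := by
  refine mem_starIdeal_iff.2 fun U hU => ?_
  by_cases h : U ⊆ T
  · rw [Finset.eq_of_subset_of_card_le h (hT.trans hU.symm).le]
    exact Ideal.mul_mem_left _ _ hf
  · obtain ⟨i, hiU, hiT⟩ := Finset.not_subset.1 h
    refine Ideal.mul_mem_right _ _ (Ideal.mem_of_dvd _ ?_
      (Ideal.subset_span (Set.mem_image_of_mem F hiU)))
    simpa using Finset.dvd_prod_of_mem F (s := Finset.univ \ T) (by simpa using hiT)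

theorem exists_notMem_mul_mem_of_mem_comap {I P : Ideal R} [P.IsPrime] {f : R}
    (hf : f ∈ (I.map (algebraMap R (Localization.AtPrime P))).comap
      (algebraMap R (Localization.AtPrime P))) : ∃ g ∉ P, g * f ∈ I := by
  rw [Ideal.mem_comap, IsLocalization.algebraMap_mem_map_algebraMap_iff P.primeCompl] at hf
  obtain ⟨g, hg, h⟩ := hf
  exact ⟨g, hg, h⟩

theorem mem_comap_of_mul_mem {I P : Ideal R} [P.IsPrime] {f g : R} (hg : g ∉ P)
    (h : g * f ∈ I) : f ∈ (I.map (algebraMap R (Localization.AtPrime P))).comap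
      (algebraMap R (Localization.AtPrime P)) := by
  rw [Ideal.mem_comap, IsLocalization.algebraMap_mem_map_algebraMap_iff P.primeCompl]
  exact ⟨g, hg, h⟩

theorem isAssociatedPrime_quotient_iff [IsNoetherianRing R] {I P : Ideal R} :
    IsAssociatedPrime P (R ⧸ I) ↔ P.IsPrime ∧ ∃ z : R, ∀ w, w ∈ P ↔ w * z ∈ I := by
  rw [isAssociatedPrime_iff]
  refine and_congr_right fun _ => ⟨?_, ?_⟩
  · rintro ⟨x, rfl⟩
    obtain ⟨z, rfl⟩ := Ideal.Quotient.mk_surjective x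
    refine ⟨z, fun w => ?_⟩
    rw [Submodule.mem_colon_singleton, Submodule.mem_bot, ← Ideal.Quotient.eq_zero_iff_mem]
    rfl
  · rintro ⟨z, hz⟩
    refine ⟨Ideal.Quotient.mk I z, Ideal.ext fun w => ?_⟩
    rw [hz, Submodule.mem_colon_singleton, Submodule.mem_bot, ← Ideal.Quotient.eq_zero_iff_mem]
    rfl

/-- Prime avoidance: otherwise `K` lies in the finite union of associated primes, hence in one of
them. -/
theorem exists_mem_regular_of_forall_associatedPrimes [IsNoetherianRing R] {I K : Ideal R}
    (h : ∀ P, IsAssociatedPrime P (R ⧸ I) → ¬ K ≤ P) :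
    ∃ g ∈ K, ∀ z, g * z ∈ I → z ∈ I := by
  by_contra! hK
  have hsub : (K : Set R) ⊆ ⋃ P ∈ associatedPrimes R (R ⧸ I), P := by
    intro g hg
    obtain ⟨z, hz, hzI⟩ := hK g hg
    rw [biUnion_associatedPrimes_eq_zero_divisors]
    refine ⟨Ideal.Quotient.mk I z, by rwa [ne_eq, Ideal.Quotient.eq_zero_iff_mem], ?_⟩
    exact Ideal.Quotient.eq_zero_iff_mem.2 hz
  have hfin := associatedPrimes.finite R (R ⧸ I)
  have := (Ideal.subset_union_prime (s := hfin.toFinset) (f := id) ⊤ ⊤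
    (fun P hP _ _ => IsAssociatedPrime.isPrime (hfin.mem_toFinset.1 hP)) (I := K)).1
    (by simpa using hsub)
  obtain ⟨P, hP, hKP⟩ := this
  exact h P (hfin.mem_toFinset.1 hP) hKP

/-- If `P` is the annihilator of `z` modulo `(F_T)`, it is also the annihilator of `z * ∏ i ∉ T, F
i` modulo the star ideal, since that product is a nonzerodivisor modulo `(F_T)`. -/
theorem IsRegularFamily.isAssociatedPrime_starIdeal [IsNoetherianRing R]
    (hF : IsRegularFamily F Finset.univ c) {T : Finset (Fin s)} (hT : T.card = c) {P : Ideal R}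
    (hP : IsAssociatedPrime P (R ⧸ Ideal.span (F '' (T : Set (Fin s))))) :
    IsAssociatedPrime P (R ⧸ starIdeal F c) := by
  rw [isAssociatedPrime_quotient_iff] at hP ⊢
  obtain ⟨hprime, z, hz⟩ := hP
  refine ⟨hprime, (∏ i ∈ Finset.univ \ T, F i ^ 1) * z, fun w => ?_⟩
  rw [hz, mul_left_comm]
  refine ⟨prod_compl_mul_mem_starIdeal hT, fun h => ?_⟩
  exact hF.of_prod_mul_mem (Finset.subset_univ T) hT.le (Finset.subset_univ _)
    Finset.sdiff_disjoint (fun _ => 1) (starIdeal_le hT h)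

/-- Forwards, the colon ideal `(F_T) ^ m : f` lies in no associated prime of `(F_T)`, so it contains
a nonzerodivisor modulo `(F_T)`, which cancels. Backwards, for an associated prime `P` annihilating
`z`, choose `T` with `z ∉ (F_T)`; the product of the `F i`, `i ∉ T`, avoids `P`, and its `m`-th
power carries `(F_T) ^ m` into `I ^ m`. -/
theorem IsRegularFamily.mem_symbolicPower_iff [IsNoetherianRing R]
    (hF : IsRegularFamily F Finset.univ c) {m : ℕ} {f : R} :
    f ∈ symbolicPower (starIdeal F c) m ↔
      ∀ T : Finset (Fin s), T.card = c → f ∈ Ideal.span (F '' (T : Set (Fin s))) ^ m := by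
  simp only [symbolicPower, Ideal.mem_iInf, Subtype.forall]
  constructor
  · intro hf T hT
    obtain ⟨g, hg, hreg⟩ := exists_mem_regular_of_forall_associatedPrimes
      (I := Ideal.span (F '' (T : Set (Fin s))))
      (K := Submodule.comap (LinearMap.mulRight R f) (Ideal.span (F '' (T : Set (Fin s))) ^ m)) (by
        intro P hP hle
        have hP' := hF.isAssociatedPrime_starIdeal hT hP
        have := hP'.isPrime
        obtain ⟨g, hgP, hgf⟩ := exists_notMem_mul_mem_of_mem_comap (hf P hP')
        exact hgP (hle (Ideal.pow_right_mono (starIdeal_le hT) m hgf)))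
    exact hF.mem_pow_of_mul_mem (Finset.subset_univ T) hT.le hreg hg
  · intro hf P hP
    have := IsAssociatedPrime.isPrime hP
    obtain ⟨-, z, hz⟩ := isAssociatedPrime_quotient_iff.1 hP
    have hzI : z ∉ starIdeal F c := fun h =>
      Ideal.IsPrime.one_notMem ‹P.IsPrime› ((hz 1).2 (by rwa [one_mul]))
    rw [mem_starIdeal_iff] at hzI
    push Not at hzI
    obtain ⟨T, hT, hzT⟩ := hzI
    refine mem_comap_of_mul_mem (g := (∏ i ∈ Finset.univ \ T, F i ^ 1) ^ m) (fun h => ?_) ?_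
    · have h1 := starIdeal_le hT ((hz _).1 (Ideal.IsPrime.mem_of_pow_mem ‹_› _ h))
      exact hzT (hF.of_prod_mul_mem (Finset.subset_univ T) hT.le (Finset.subset_univ _)
        Finset.sdiff_disjoint (fun _ => 1) h1)
    · have h1 : Ideal.span {∏ i ∈ Finset.univ \ T, F i ^ 1} *
          Ideal.span (F '' (T : Set (Fin s))) ≤ starIdeal F c :=
        Ideal.span_singleton_mul_le_iff.2 fun w hw => prod_compl_mul_mem_starIdeal hT hw
      refine Ideal.pow_right_mono h1 m ?_
      rw [mul_pow]
      exact Ideal.mul_mem_mul (Ideal.pow_mem_pow (Ideal.mem_span_singleton_self _) _) (hf T hT)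

/-- The symbolic powers of the star ideal are generated by monomials. -/
theorem IsRegularFamily.symbolicPower_eq_span [IsNoetherianRing R]
    (hF : IsRegularFamily F Finset.univ c) (m : ℕ) :
    symbolicPower (starIdeal F c) m =
      Ideal.span {g | ∃ b, SdegGE c m b ∧ g = monomialIn F b} := by
  refine le_antisymm (fun f hf => ?_) (Ideal.span_le.2 ?_)
  · rw [hF.mem_symbolicPower_iff] at hf
    refine Ideal.span_mono ?_ (mem_span_monomials_of_forall_mem_pow c (m := m) 0 hF
      (fun T _ hT => by simpa using hf T hT))
    rintro _ ⟨b, hb, rfl⟩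
    exact ⟨b, fun T hT => by simpa using hb T (Finset.subset_univ T) hT, rfl⟩
  · rintro _ ⟨b, hb, rfl⟩
    exact hF.mem_symbolicPower_iff.2 fun T hT =>
      prod_pow_mem_span_pow F (Finset.subset_univ T) b (hb T hT)

theorem IsRegularFamily.starIdeal_eq_span (hF : IsRegularFamily F Finset.univ c) :
    starIdeal F c = Ideal.span {g | ∃ b, SdegGE c 1 b ∧ g = monomialIn F b} := by
  refine le_antisymm (fun f hf => ?_) (Ideal.span_le.2 ?_)
  · rw [mem_starIdeal_iff] at hf
    refine Ideal.span_mono ?_ (mem_span_monomials_of_forall_mem_pow c (m := 1) 0 hF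
      (fun T _ hT => by simpa using hf T hT))
    rintro _ ⟨b, hb, rfl⟩
    exact ⟨b, fun T hT => by simpa using hb T (Finset.subset_univ T) hT, rfl⟩
  · rintro _ ⟨b, hb, rfl⟩
    exact mem_starIdeal_iff.2 fun T hT => by
      simpa [monomialIn] using prod_pow_mem_span_pow F (Finset.subset_univ T) b (hb T hT)

end SymbolicPower

/-! ### Ordinary powers and the degree in the family -/

section OrdinaryPower

variable {R : Type u} [CommRing R] {s c : ℕ} {F : Fin s → R}

theorem monomialIn_add (a b : Fin s → ℕ) :
    monomialIn F (a + b) = monomialIn F a * monomialIn F b := by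
  simp [monomialIn, pow_add, Finset.prod_mul_distrib]

theorem SdegGE.add {m n : ℕ} {a b : Fin s → ℕ} (ha : SdegGE c m a) (hb : SdegGE c n b) :
    SdegGE c (m + n) (a + b) := fun T hT => by
  simpa [Finset.sum_add_distrib] using Nat.add_le_add (ha T hT) (hb T hT)

/-- Fewer than `c` exponents can vanish, so at least `s + 1 - c` are positive. -/
theorem SdegGE.le_sum {b : Fin s → ℕ} (hb : SdegGE c 1 b) : s + 1 ≤ c + ∑ i, b i := by
  have hZ : (Finset.univ.filter fun i => b i = 0).card < c := by
    by_contra! h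
    obtain ⟨T, hTZ, hT⟩ := Finset.exists_subset_card_eq h
    have h1 := hb T hT
    have h2 : ∑ i ∈ T, b i = 0 :=
      Finset.sum_eq_zero fun i hi => (Finset.mem_filter.1 (hTZ hi)).2
    omega
  have h1 := Finset.card_filter_add_card_filter_not (s := Finset.univ) (fun i => b i = 0)
  have h2 : (Finset.univ.filter fun i => ¬ b i = 0).card ≤ ∑ i, b i := by
    rw [Finset.card_filter]
    exact Finset.sum_le_sum fun i _ => by split_ifs <;> omega
  rw [Finset.card_univ, Fintype.card_fin] at h1
  omega

/-- The ordinary power `I_c ^ m` is generated by monomials of degree at least `m (s + 1 - c)` in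
the family. -/
theorem IsRegularFamily.starIdeal_pow_le (hF : IsRegularFamily F Finset.univ c) (m : ℕ) :
    starIdeal F c ^ m ≤ Ideal.span {g | ∃ b, SdegGE c m b ∧ m * (s + 1) ≤ m * c + ∑ i, b i ∧
      g = monomialIn F b} := by
  induction m with
  | zero =>
    have : (1 : R) ∈ Ideal.span {g | ∃ b, SdegGE c 0 b ∧ 0 * (s + 1) ≤ 0 * c + ∑ i, b i ∧
        g = monomialIn F b} :=
      Ideal.subset_span ⟨0, fun T _ => Nat.zero_le _, by simp, by simp [monomialIn]⟩
    rw [(Ideal.eq_top_iff_one _).2 this]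
    exact le_top
  | succ m ih =>
    rw [pow_succ]
    refine (Ideal.mul_mono ih hF.starIdeal_eq_span.le).trans ?_
    rw [Ideal.span_mul_span', Ideal.span_le]
    rintro _ ⟨_, ⟨b, hb, hbm, rfl⟩, _, ⟨d, hd, rfl⟩, rfl⟩
    refine Ideal.subset_span ⟨b + d, hb.add hd, ?_, (monomialIn_add b d).symm⟩
    have := hd.le_sum
    simp only [Pi.add_apply, Finset.sum_add_distrib, add_mul, one_mul]
    omega

/-- The exponents of the elements of `G'_{c,(m)}`. -/
def IsGenExponent' (c m : ℕ) (a : Fin s → ℕ) : Prop :=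
  IsGenExponent c m a ∧ s + 2 - c ≤ (Finset.univ.filter fun i => a i ≠ 0).card

/-- The degree is `(s - c) * a j + m`. The large support forces a second positive exponent inside
`T` besides `a j`, whence `a j < m`. -/
theorem IsGenExponent'.sum_lt {m : ℕ} (hcs : c < s) {a : Fin s → ℕ} (ha : IsGenExponent' c m a) :
    m * c + ∑ i, a i < m * (s + 1) := by
  obtain ⟨⟨T, hT, hTm, j, hj, hle, heq⟩, hsupp⟩ := ha
  have hcard : (Finset.univ \ T).card = s - c := by
    rw [Finset.card_sdiff_of_subset (Finset.subset_univ T), Finset.card_univ, Fintype.card_fin, hT]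
  have hsum : ∑ i, a i = (s - c) * a j + m := by
    rw [← Finset.sum_sdiff (Finset.subset_univ T), hTm, Finset.sum_congr rfl fun i hi =>
      heq i (Finset.mem_sdiff.1 hi).2, Finset.sum_const, hcard, smul_eq_mul]
  obtain ⟨l, hl, hl'⟩ : ∃ l ∈ Finset.univ.filter (fun i => a i ≠ 0),
      l ∉ insert j (Finset.univ \ T) := by
    refine Finset.exists_mem_notMem_of_card_lt_card
      ((Finset.card_insert_le _ _).trans_lt ?_)
    omega
  simp only [Finset.mem_filter, Finset.mem_univ, true_and, Finset.mem_insert, Finset.mem_sdiff,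
    not_or, not_not] at hl hl'
  have hlt : a j < m := by
    rw [← hTm, ← Finset.add_sum_erase _ _ hj]
    have : a l ≤ ∑ k ∈ T.erase j, a k :=
      Finset.single_le_sum (f := a) (fun _ _ => Nat.zero_le _)
        (Finset.mem_erase.2 ⟨hl'.1, hl'.2⟩)
    omega
  obtain ⟨d, rfl⟩ := Nat.exists_eq_add_of_lt hcs
  rw [hsum]
  have h1 : c + d + 1 - c = d + 1 := by omega
  rw [h1]
  nlinarith

theorem IsRegularFamily.starIdeal_pow_le_of_isGenExponent' (hF : IsRegularFamily F Finset.univ c)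
    (hcs : c < s) {m : ℕ} {a : Fin s → ℕ} (ha : IsGenExponent' c m a) :
    starIdeal F c ^ m ≤ Ideal.span {g | ∃ b, b ≠ a ∧ SdegGE c m b ∧ g = monomialIn F b} := by
  refine (hF.starIdeal_pow_le m).trans (Ideal.span_mono ?_)
  rintro _ ⟨b, hb, hbm, rfl⟩
  refine ⟨b, ?_, hb, rfl⟩
  rintro rfl
  have := ha.sum_lt hcs
  omega

theorem prod_mem_starIdeal {S : Finset (Fin s)} (hS : s < c + S.card) :
    ∏ i ∈ S, F i ∈ starIdeal F c := by
  refine mem_starIdeal_iff.2 fun U hU => ?_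
  obtain ⟨i, hi⟩ : (U ∩ S).Nonempty := by
    rw [← Finset.card_pos]
    have h1 := Finset.card_union_add_card_inter U S
    have h2 := Finset.card_le_univ (U ∪ S)
    rw [Fintype.card_fin] at h2
    omega
  rw [Finset.mem_inter] at hi
  exact Ideal.mem_of_dvd _ (Finset.dvd_prod_of_mem F hi.2)
    (Ideal.subset_span (Set.mem_image_of_mem F hi.1))

/-- The support is just `j` together with the complement of `T`, so all nonzero exponents equal `a j
= m`. -/
theorem IsGenExponent.monomialIn_mem_pow (hcs : c < s) {m : ℕ} {a : Fin s → ℕ} (hm : 1 ≤ m)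
    (ha : IsGenExponent c m a) (ha' : ¬ IsGenExponent' c m a) :
    monomialIn F a ∈ starIdeal F c ^ m := by
  have hlt : (Finset.univ.filter fun i => a i ≠ 0).card < s + 2 - c := by
    by_contra! h
    exact ha' ⟨ha, h⟩
  obtain ⟨T, hT, hTm, j, hj, hle, heq⟩ := ha
  have hcard : (insert j (Finset.univ \ T)).card = s - c + 1 := by
    rw [Finset.card_insert_of_notMem (by simp [hj]),
      Finset.card_sdiff_of_subset (Finset.subset_univ T), Finset.card_univ, Fintype.card_fin, hT]
  have hj0 : a j ≠ 0 := by
    intro h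
    have : ∑ i ∈ T, a i = 0 := Finset.sum_eq_zero fun i _ => Nat.le_zero.1 (h ▸ hle i)
    omega
  have hS : insert j (Finset.univ \ T) = Finset.univ.filter fun i => a i ≠ 0 := by
    refine Finset.eq_of_subset_of_card_le (fun i hi => ?_) (by omega)
    rw [Finset.mem_filter]
    refine ⟨Finset.mem_univ i, ?_⟩
    rcases Finset.mem_insert.1 hi with rfl | hi
    · exact hj0
    · rwa [heq i (Finset.mem_sdiff.1 hi).2]
  have hzero : ∀ i, i ∉ insert j (Finset.univ \ T) → a i = 0 := by
    intro i hi
    rw [hS] at hi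
    simpa using hi
  have hjm : a j = m := by
    rw [← hTm]
    refine (Finset.sum_eq_single_of_mem j hj fun i hi hij => hzero i ?_).symm
    simp [hij, hi]
  have hprod : monomialIn F a = (∏ i ∈ insert j (Finset.univ \ T), F i) ^ m := by
    rw [monomialIn, ← Finset.prod_subset (Finset.subset_univ (insert j (Finset.univ \ T)))
      (fun i _ hi => by rw [hzero i hi, pow_zero]), ← Finset.prod_pow]
    refine Finset.prod_congr rfl fun i hi => ?_
    rcases Finset.mem_insert.1 hi with rfl | hi
    · rw [hjm]
    · rw [heq i (Finset.mem_sdiff.1 hi).2, hjm]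
  rw [hprod]
  exact Ideal.pow_mem_pow (prod_mem_starIdeal (by omega)) m

end OrdinaryPower

/-! ### Normal forms versus exponent vectors -/

section NormalForm

variable {R : Type u} [CommRing R] {s c : ℕ} {F : Fin s → R}

/-- The exponents of the product of the squarefree monomials with supports in `L`. -/
def exponents (L : List (Finset (Fin s))) (i : Fin s) : ℕ :=
  (L.map fun S => if i ∈ S then 1 else 0).sum

theorem prod_eq_monomialIn (F : Fin s → R) (L : List (Finset (Fin s))) :
    (L.map fun S => ∏ i ∈ S, F i).prod = monomialIn F (exponents L) := by
  induction L with
  | nil => simp [monomialIn, exponents]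
  | cons S L ih =>
    rw [List.map_cons, List.prod_cons, ih]
    simp only [monomialIn, exponents, List.map_cons, List.sum_cons, pow_add,
      Finset.prod_mul_distrib]
    congr 1
    simp [Finset.prod_ite_mem, pow_ite]

theorem sum_exponents (T : Finset (Fin s)) (L : List (Finset (Fin s))) :
    ∑ i ∈ T, exponents L i = (L.map fun S => (S ∩ T).card).sum := by
  induction L with
  | nil => simp [exponents]
  | cons S L ih =>
    simp only [exponents, List.map_cons, List.sum_cons, Finset.sum_add_distrib] at ih ⊢
    rw [ih, Finset.sum_boole, Finset.filter_mem_eq_inter, Finset.inter_comm]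
    rfl

theorem exponents_le_length (L : List (Finset (Fin s))) (i : Fin s) :
    exponents L i ≤ L.length := by
  induction L with
  | nil => simp [exponents]
  | cons S L ih =>
    simp only [exponents, List.map_cons, List.sum_cons, List.length_cons] at ih ⊢
    split_ifs <;> omega

theorem exponents_eq_length {L : List (Finset (Fin s))} {i : Fin s} (h : ∀ S ∈ L, i ∈ S) :
    exponents L i = L.length := by
  induction L with
  | nil => simp [exponents]
  | cons S L ih =>
    have h1 := ih fun S hS => h S (List.mem_cons_of_mem _ hS)
    simp only [exponents, List.map_cons, List.sum_cons, List.length_cons] at h1 ⊢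
    rw [if_pos (h S List.mem_cons_self), h1, add_comm]

theorem exponents_ne_zero_iff {L : List (Finset (Fin s))} {i : Fin s} :
    exponents L i ≠ 0 ↔ ∃ S ∈ L, i ∈ S := by
  simp [exponents, List.sum_eq_zero_iff]

theorem exists_forall_subset {L : List (Finset (Fin s))} (hL : L ≠ [])
    (h : L.Pairwise fun S S' => S' ⊆ S) : ∃ S₀ ∈ L, ∀ S ∈ L, S₀ ⊆ S := by
  induction L with
  | nil => exact absurd rfl hL
  | cons S L ih =>
    rw [List.pairwise_cons] at h
    rcases eq_or_ne L [] with rfl | hL'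
    · exact ⟨S, List.mem_cons_self, by simp⟩
    · obtain ⟨S₀, hS₀, hsub⟩ := ih hL' h.2
      refine ⟨S₀, List.mem_cons_of_mem _ hS₀, fun U hU => ?_⟩
      rcases List.mem_cons.1 hU with rfl | hU
      · exact h.1 S₀ hS₀
      · exact hsub U hU

theorem exists_forall_superset {L : List (Finset (Fin s))} (hL : L ≠ [])
    (h : L.Pairwise fun S S' => S' ⊆ S) : ∃ S₁ ∈ L, ∀ S ∈ L, S ⊆ S₁ := by
  cases L with
  | nil => exact absurd rfl hL
  | cons S L =>
    rw [List.pairwise_cons] at h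
    refine ⟨S, List.mem_cons_self, fun U hU => ?_⟩
    rcases List.mem_cons.1 hU with rfl | hU
    · exact subset_rfl
    · exact h.1 U hU

theorem card_inter_of_union_eq_univ {S T : Finset (Fin s)} (hT : T.card = c)
    (h : S ∪ T = Finset.univ) : (S ∩ T).card = c + S.card - s := by
  have := Finset.card_union_add_card_inter S T
  rw [h, Finset.card_univ, Fintype.card_fin] at this
  omega

theorem ne_nil_of_sdeg {m : ℕ} (hm : 1 ≤ m) {L : List (Finset (Fin s))} (h : sdeg c L = m) :
    L ≠ [] := by
  rintro rfl
  simp [sdeg] at h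
  omega

/-- Let `S₀` be the smallest factor. Its complement has fewer than `c` elements, so it extends to a
`T` of size `c` meeting `S₀` in some `j`. Exponents on `S₀` equal the length of `L`, and each factor
`S` covers the complement of `T`, so it contributes `c + S.card - s` to the sum over `T`. -/
theorem isGenExponent_exponents (hcs : c < s) {m : ℕ} (hm : 1 ≤ m)
    {L : List (Finset (Fin s))} (hL : L.Pairwise fun S S' => S' ⊆ S) (hdeg : sdeg c L = m)
    (hcard : ∀ S ∈ L, s + 1 - c ≤ S.card) : IsGenExponent c m (exponents L) := by
  obtain ⟨S₀, hS₀, hsub⟩ := exists_forall_subset (ne_nil_of_sdeg hm hdeg) hL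
  have h0 := hcard S₀ hS₀
  have hle : S₀.card ≤ s := by simpa using S₀.card_le_univ
  have hcompl : S₀ᶜ.card = s - S₀.card := by rw [Finset.card_compl, Fintype.card_fin]
  obtain ⟨T, hST, hT⟩ := Finset.exists_superset_card_eq (s := S₀ᶜ) (n := c) (by omega)
    (by rw [Fintype.card_fin]; omega)
  obtain ⟨j, hjT, hj⟩ := Finset.exists_mem_notMem_of_card_lt_card
    (show S₀ᶜ.card < T.card by omega)
  have hlen : ∀ i ∈ S₀, exponents L i = L.length := fun i hi =>
    exponents_eq_length fun S hS => hsub S hS hi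
  have hj' : exponents L j = L.length := hlen j (by simpa using hj)
  refine ⟨T, hT, ?_, j, hjT, fun i => hj' ▸ exponents_le_length L i, fun i hi => ?_⟩
  · rw [sum_exponents, ← hdeg, sdeg]
    refine congrArg List.sum (List.map_congr_left fun S hS => ?_)
    refine card_inter_of_union_eq_univ hT (Finset.eq_univ_iff_forall.2 fun i => ?_)
    by_cases hi : i ∈ S₀
    · exact Finset.mem_union_left _ (hsub S hS hi)
    · exact Finset.mem_union_right _ (hST (Finset.mem_compl.2 hi))
  · rw [hj', hlen i]
    by_contra h
    exact hi (hST (Finset.mem_compl.2 h))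

theorem IsGenExponent.exists_list (hcs : c < s) {m : ℕ} {a : Fin s → ℕ}
    (ha : IsGenExponent c m a) : ∃ L : List (Finset (Fin s)), (∀ S ∈ L, S.Nonempty) ∧
      L.Pairwise (fun S S' => S' ⊆ S) ∧ exponents L = a ∧ sdeg c L = m ∧
      ∀ S ∈ L, s + 1 - c ≤ S.card := by
  obtain ⟨T, hT, hTm, j, hj, hle, heq⟩ := ha
  -- The normal form consists of the superlevel sets of `a`; each contains `j` and the complement of
  -- `T`.
  set L : List (Finset (Fin s)) :=
    (List.range (a j)).map fun k => Finset.univ.filter fun i => k < a i with hL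
  have hexp : exponents L = a := by
    funext i
    have h1 : ∀ n, ((List.range n).map fun k => if k < a i then 1 else 0).sum = min n (a i) := by
      intro n
      induction n with
      | zero => simp
      | succ n ih =>
        rw [List.range_succ, List.map_append, List.sum_append, ih]
        simp only [List.map_cons, List.map_nil, List.sum_cons, List.sum_nil]
        split_ifs <;> omega
    rw [exponents, hL, List.map_map]
    simp only [Function.comp_def, Finset.mem_filter, Finset.mem_univ, true_and]
    rw [h1, min_eq_right (hle i)]
  have hmem : ∀ S ∈ L, j ∈ S ∧ ∀ i ∉ T, i ∈ S := by
    intro S hS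
    obtain ⟨k, hk, rfl⟩ := List.mem_map.1 hS
    rw [List.mem_range] at hk
    refine ⟨by simpa using hk, fun i hi => ?_⟩
    simpa [heq i hi] using hk
  refine ⟨L, fun S hS => ⟨j, (hmem S hS).1⟩, ?_, hexp, ?_, fun S hS => ?_⟩
  · rw [hL, List.pairwise_map]
    refine List.pairwise_lt_range.imp fun {k l} hkl i hi => ?_
    simp only [Finset.mem_filter, Finset.mem_univ, true_and] at hi ⊢
    omega
  · rw [← hTm, ← hexp, sum_exponents, sdeg]
    refine congrArg List.sum (List.map_congr_left fun S hS => ?_)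
    refine (card_inter_of_union_eq_univ hT (Finset.eq_univ_iff_forall.2 fun i => ?_)).symm
    by_cases hi : i ∈ T
    · exact Finset.mem_union_right _ hi
    · exact Finset.mem_union_left _ ((hmem S hS).2 i hi)
  · have hsub : insert j Tᶜ ⊆ S := by
      intro i hi
      rcases Finset.mem_insert.1 hi with rfl | hi
      · exact (hmem S hS).1
      · exact (hmem S hS).2 i (Finset.mem_compl.1 hi)
    have := Finset.card_le_card hsub
    rw [Finset.card_insert_of_notMem (by simp [hj]), Finset.card_compl, Fintype.card_fin, hT]
      at this
    omega

theorem gens_eq_image (hcs : c < s) {m : ℕ} (hm : 1 ≤ m) :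
    gens F c m = monomialIn F '' {a | IsGenExponent c m a} := by
  ext M
  constructor
  · rintro ⟨L, hL, hdeg, hcard⟩
    exact ⟨exponents L, isGenExponent_exponents hcs hm hL.antitone hdeg hcard,
      (prod_eq_monomialIn F L).symm.trans hL.eq_prod.symm⟩
  · rintro ⟨a, ha, rfl⟩
    obtain ⟨L, h1, h2, h3, h4, h5⟩ := ha.exists_list hcs
    exact ⟨L, ⟨h1, h2, by rw [prod_eq_monomialIn, h3]⟩, h4, h5⟩

/-- The exponents of a monomial in a regular family are unique. -/
theorem IsRegularFamily.monomialIn_injective (hF : IsRegularFamily F Finset.univ c) (hc : 1 ≤ c)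
    {I : Ideal R} (hI : I ≠ ⊤) (hFI : ∀ i, F i ∈ I) : Function.Injective (monomialIn F) := by
  have key : ∀ a b : Fin s → ℕ, monomialIn F a = monomialIn F b → ∀ i, b i ≤ a i := by
    intro a b hab i
    by_contra! hlt
    have hsplit : ∀ d : Fin s → ℕ,
        monomialIn F d = F i ^ d i * ∏ k ∈ Finset.univ.erase i, F k ^ d k :=
      fun d => (Finset.mul_prod_erase _ _ (Finset.mem_univ i)).symm
    obtain ⟨e, he⟩ := Nat.exists_eq_add_of_lt hlt
    -- After cancelling `F i ^ a i`, a product of the other members would lie in `(F i)`. These are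
    -- nonzerodivisors modulo `F i` because `1 ≤ c`, so `1` would lie in `(F i)`.
    have h1 : (∏ k ∈ {i}, F k ^ a k) * ((∏ k ∈ Finset.univ.erase i, F k ^ a k) -
        F i * (F i ^ e * ∏ k ∈ Finset.univ.erase i, F k ^ b k)) ∈
        Ideal.span (F '' ((∅ : Finset (Fin s)) : Set (Fin s))) := by
      rw [hsplit a, hsplit b, he] at hab
      rw [Finset.prod_singleton, mul_sub, hab]
      have : F i ^ (a i + e + 1) * ∏ k ∈ Finset.univ.erase i, F k ^ b k -
          F i ^ a i * (F i * (F i ^ e * ∏ k ∈ Finset.univ.erase i, F k ^ b k)) = 0 := by ring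
      rw [this]
      exact zero_mem _
    have h2 := hF.of_prod_mul_mem (Finset.empty_subset _) (by simp) (Finset.subset_univ _)
      (Finset.disjoint_empty_right _) a h1
    rw [Finset.coe_empty, Set.image_empty, Ideal.span_empty, Ideal.mem_bot, sub_eq_zero] at h2
    have h3 : (∏ k ∈ Finset.univ.erase i, F k ^ a k) * 1 ∈
        Ideal.span (F '' (({i} : Finset (Fin s)) : Set (Fin s))) := by
      rw [mul_one, h2]
      exact Ideal.mul_mem_right _ _ (Ideal.subset_span (by simp))
    have h4 := hF.of_prod_mul_mem (Finset.subset_univ _) (by simpa using hc)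
      (Finset.subset_univ _) (Finset.disjoint_singleton_right.2 (Finset.notMem_erase i _)) a h3
    refine hI ((Ideal.eq_top_iff_one I).2 (Ideal.span_le.2 ?_ h4))
    rintro _ ⟨k, -, rfl⟩
    exact hFI k
  exact fun a b hab => funext fun i => le_antisymm (key b a hab.symm i) (key a b hab i)

theorem supp_monomialIn (hinj : Function.Injective (monomialIn F)) (a : Fin s → ℕ) :
    supp F (monomialIn F a) = ((Finset.univ.filter fun i => a i ≠ 0 : Finset (Fin s)) : Set _) := by
  ext i
  simp only [supp, Set.mem_ofPred_eq, Finset.coe_filter, Finset.mem_univ, true_and]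
  refine ⟨?_, fun h => ⟨a, rfl, h⟩⟩
  rintro ⟨b, hb, hi⟩
  rwa [hinj hb]

theorem gens'_eq_image (hinj : Function.Injective (monomialIn F)) (hcs : c < s)
    {m : ℕ} (hm : 1 ≤ m) : gens' F c m = monomialIn F '' {a | IsGenExponent' c m a} := by
  ext M
  simp only [gens', gens_eq_image hcs hm, Set.mem_ofPred_eq]
  constructor
  · rintro ⟨⟨a, ha, rfl⟩, h⟩
    rw [supp_monomialIn hinj, Set.ncard_coe_finset] at h
    exact ⟨a, ⟨ha, h⟩, rfl⟩
  · rintro ⟨a, ⟨ha, h⟩, rfl⟩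
    refine ⟨⟨a, ha, rfl⟩, ?_⟩
    rwa [supp_monomialIn hinj, Set.ncard_coe_finset]

/-- The largest factor of a normal form has the same support as the whole monomial. -/
theorem gens'_eq_exists_factor (hinj : Function.Injective (monomialIn F))
    {m : ℕ} (hm : 1 ≤ m) : gens' F c m = {M | ∃ L, IsNormalForm F M L ∧ sdeg c L = m ∧
      (∀ S ∈ L, s + 1 - c ≤ S.card) ∧ ∃ S ∈ L, s + 2 - c ≤ S.card} := by
  ext M
  constructor
  · rintro ⟨⟨L, hL, hdeg, hcard⟩, h⟩
    obtain ⟨S₁, hS₁, hsup⟩ := exists_forall_superset (ne_nil_of_sdeg hm hdeg) hL.antitone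
    refine ⟨L, hL, hdeg, hcard, S₁, hS₁, h.trans ?_⟩
    rw [hL.eq_prod, prod_eq_monomialIn, supp_monomialIn hinj, Set.ncard_coe_finset]
    refine Finset.card_le_card fun i hi => ?_
    obtain ⟨S, hS, hiS⟩ := exponents_ne_zero_iff.1 (Finset.mem_filter.1 hi).2
    exact hsup S hS hiS
  · rintro ⟨L, hL, hdeg, hcard, S, hS, h⟩
    refine ⟨⟨L, hL, hdeg, hcard⟩, h.trans ?_⟩
    rw [hL.eq_prod, prod_eq_monomialIn, supp_monomialIn hinj, Set.ncard_coe_finset]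
    refine Finset.card_le_card fun i hi => ?_
    exact Finset.mem_filter.2 ⟨Finset.mem_univ i, exponents_ne_zero_iff.2 ⟨S, hS, hi⟩⟩

theorem finite_isGenExponent' (c m : ℕ) : {a : Fin s → ℕ | IsGenExponent' c m a}.Finite := by
  refine (Set.finite_Iic (fun _ : Fin s => m)).subset ?_
  rintro a ⟨⟨T, -, rfl, j, hj, hle, -⟩, -⟩ i
  exact (hle i).trans (Finset.single_le_sum (f := a) (fun _ _ => Nat.zero_le _) hj)

end NormalForm

/-! ### Counting generators through a map to a field -/

section MinimalGenerators

variable {R W ι k : Type*} [CommRing R] [AddCommGroup W] [Module R W] [Field k]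

/-- A redundant generator would give a relation in which its own coefficient is `1`. -/
theorem isMinimalGenerating_of_relations (φ : R →+* k) {v : ι → W}
    (hspan : Submodule.span R (Set.range v) = ⊤)
    (hv : ∀ r : ι →₀ R, Finsupp.linearCombination R v r = 0 → ∀ i, φ (r i) = 0) :
    IsMinimalGenerating (R := R) v := by
  classical
  refine ⟨hspan, fun T hT => Set.eq_univ_of_forall fun i => ?_⟩
  by_contra hi
  have hmem : v i ∈ Submodule.span R (v '' T) := hT ▸ Submodule.mem_top
  obtain ⟨l, hl, hlv⟩ := (Finsupp.mem_span_image_iff_linearCombination R).1 hmem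
  have hli : l i = 0 := by
    by_contra h
    exact hi (hl (Finsupp.mem_support_iff.2 h))
  have h := hv (Finsupp.single i 1 - l) (by simp [hlv]) i
  simp [hli] at h

/-- Express `v` through a smallest generating set by a matrix `B`, and that set through `v` by `A`.
The rows of `B * A - 1` are relations of `v`, so `φ` turns `B * A` into the identity, and ranks over
`k` bound the size. -/
theorem spanFinrank_eq_card_of_relations [Fintype ι] (φ : R →+* k) {v : ι → W}
    (hspan : Submodule.span R (Set.range v) = ⊤)
    (hv : ∀ r : ι →₀ R, Finsupp.linearCombination R v r = 0 → ∀ i, φ (r i) = 0) :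
    (⊤ : Submodule R W).spanFinrank = Fintype.card ι := by
  classical
  refine le_antisymm ?_ ?_
  · rw [← hspan]
    refine (Submodule.spanFinrank_span_le_ncard_of_finite (Set.finite_range v)).trans ?_
    rw [← Set.image_univ, ← Nat.card_eq_fintype_card, ← Set.ncard_univ]
    exact Set.ncard_image_le
  · have hfg : (⊤ : Submodule R W).FG := hspan ▸ Submodule.fg_span (Set.finite_range v)
    obtain ⟨S, hS, hSspan⟩ := hfg.exists_span_finset_card_eq_spanFinrank
    rw [← hS, ← Fintype.card_coe]
    have hB : ∀ i, ∃ B : S → R, ∑ w, B w • (w : W) = v i := fun i => by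
      have : v i ∈ Submodule.span R (Set.range ((↑) : S → W)) := by
        rw [Subtype.range_coe]
        exact hSspan ▸ Submodule.mem_top
      exact (Submodule.mem_span_range_iff_exists_fun R).1 this
    have hA : ∀ w : S, ∃ A : ι → R, ∑ i, A i • v i = (w : W) := fun w =>
      (Submodule.mem_span_range_iff_exists_fun R).1 (hspan ▸ Submodule.mem_top)
    choose B hB using hB
    choose A hA using hA
    have hprod : (Matrix.of B).map φ * (Matrix.of A).map φ = (1 : Matrix ι ι k) := by
      rw [← Matrix.map_mul]
      ext i j
      have hrel : Finsupp.linearCombination R v (Finsupp.equivFunOnFinite.symm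
          fun l => ∑ w, B i w * A w l - if i = l then 1 else 0) = 0 := by
        rw [Finsupp.linearCombination_apply, Finsupp.sum_fintype _ _ (by simp)]
        simp only [Finsupp.equivFunOnFinite_symm_apply_apply, sub_smul,
          Finset.sum_sub_distrib, ite_smul, one_smul, zero_smul, Finset.sum_ite_eq,
          Finset.mem_univ, if_true, Finset.sum_smul]
        rw [Finset.sum_comm, sub_eq_zero, ← hB i]
        refine Finset.sum_congr rfl fun w _ => ?_
        conv_rhs => rw [← hA w, Finset.smul_sum]
        simp only [mul_smul]
      have h := hv _ hrel j
      rw [Finsupp.equivFunOnFinite_symm_apply_apply, map_sub, sub_eq_zero] at h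
      rw [Matrix.map_apply, Matrix.mul_apply]
      refine h.trans ?_
      rw [Matrix.one_apply, apply_ite φ, map_one, map_zero]
    calc Fintype.card ι = (1 : Matrix ι ι k).rank := Matrix.rank_one.symm
      _ ≤ ((Matrix.of B).map φ).rank := hprod ▸ Matrix.rank_mul_le_left _ _
      _ ≤ Fintype.card S := Matrix.rank_le_card_width _

end MinimalGenerators

/-! ### From regular sequences of forms to regular families -/

section RegularSequences

open RingTheory.Sequence

theorem isRegularFamily_of_isRegular {R : Type u} [CommRing R] {s c : ℕ} (hcs : c < s)
    {F : Fin s → R} (hreg : ∀ e : Fin (c + 1) ↪ Fin s, IsRegular R (List.ofFn fun j => F (e j))) :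
    IsRegularFamily F Finset.univ c := by
  intro i _ T _ hiT hTc h hh
  -- List `T` first, then `i`, then pad with unused indices to length exactly `c + 1`; regularity at
  -- the position of `i` is the claim.
  set l : List (Fin s) :=
    T.toList ++ i :: ((Finset.univ \ insert i T).toList.take (c - T.card)) with hl
  have hcard : (Finset.univ \ insert i T).card = s - (T.card + 1) := by
    rw [Finset.card_sdiff_of_subset (Finset.subset_univ _), Finset.card_univ, Fintype.card_fin,
      Finset.card_insert_of_notMem hiT]
  have hlen : l.length = c + 1 := by
    simp only [hl, List.length_append, Finset.length_toList, List.length_cons, List.length_take,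
      hcard]
    omega
  have hrest : ∀ k ∈ (Finset.univ \ insert i T).toList.take (c - T.card), k ≠ i ∧ k ∉ T := by
    intro k hk
    simpa using Finset.mem_toList.1 (List.mem_of_mem_take hk)
  have hnodup : l.Nodup := by
    rw [hl, List.nodup_append, List.nodup_cons]
    refine ⟨T.nodup_toList, ⟨fun h => (hrest i h).1 rfl,
      (Finset.nodup_toList _).sublist (List.take_sublist _ _)⟩, ?_⟩
    rintro k hk k' hk' rfl
    rw [Finset.mem_toList] at hk
    rcases List.mem_cons.1 hk' with rfl | hk'
    · exact hiT hk
    · exact (hrest k hk').2 hk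
  have hofFn : (List.ofFn fun j : Fin (c + 1) => F (l.get (Fin.cast hlen.symm j))) = l.map F := by
    refine List.ext_getElem (by simp [hlen]) fun n h1 h2 => ?_
    simp only [List.getElem_ofFn, List.getElem_map, List.get_eq_getElem, Fin.val_cast]
  have hw := (hreg ⟨fun j => l.get (Fin.cast hlen.symm j), fun j j' hjj' =>
    Fin.cast_injective _ (List.nodup_iff_injective_get.1 hnodup hjj')⟩).toIsWeaklyRegular
  rw [show (List.ofFn fun j => F ((⟨fun j => l.get (Fin.cast hlen.symm j), fun j j' hjj' =>
    Fin.cast_injective _ (List.nodup_iff_injective_get.1 hnodup hjj')⟩ :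
      Fin (c + 1) ↪ Fin s) j)) = l.map F from hofFn, hl, List.map_append, List.map_cons,
    isWeaklyRegular_append_iff, isWeaklyRegular_cons_iff] at hw
  have hT : Ideal.ofList (T.toList.map F) = Ideal.span (F '' (T : Set (Fin s))) := by
    refine congrArg Ideal.span (Set.ext fun x => ?_)
    simp
  have hi := (isSMulRegular_quotient_iff_mem_of_smul_mem _ _).1 hw.2.1 h
  rw [smul_eq_mul, smul_eq_mul, Ideal.mul_top, hT] at hi
  exact hi hh

/-- A form with nonzero constant term is a nonzero constant, hence a unit, and a regular sequence
generates a proper ideal. -/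
theorem constantCoeff_eq_zero_of_isRegular {σ k : Type*} [Field k] {f : MvPolynomial σ k}
    {d : ℕ} (hf : f.IsHomogeneous d) {l : List (MvPolynomial σ k)}
    (hl : IsRegular (MvPolynomial σ k) l) (hfl : f ∈ l) : MvPolynomial.constantCoeff f = 0 := by
  by_contra h
  have hd : d = 0 := by
    by_contra hd
    exact h (hf.coeff_eq_zero (by simpa using Ne.symm hd))
  subst hd
  rw [← MvPolynomial.totalDegree_zero_iff_isHomogeneous,
    MvPolynomial.totalDegree_eq_zero_iff_eq_C] at hf
  have hunit : IsUnit f := by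
    rw [hf]
    exact (IsUnit.mk0 _ h).map MvPolynomial.C
  refine hl.top_ne_smul ?_
  rw [smul_eq_mul, Ideal.mul_top]
  exact (Ideal.eq_top_of_isUnit_mem (Ideal.ofList l) (Ideal.subset_span (s := {x | x ∈ l}) hfl) hunit).symm

end RegularSequences

/-! ### Generation and independence in the quotient -/

section Main

variable {R : Type u} [CommRing R] {s c m : ℕ} {F : Fin s → R}

theorem IsRegularFamily.gens'_subset [IsNoetherianRing R] (hF : IsRegularFamily F Finset.univ c)
    (hcs : c < s) (hm : 1 ≤ m) {M : R} (hM : M ∈ gens' F c m) :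
    M ∈ symbolicPower (starIdeal F c) m := by
  have hgen := hM.1
  rw [gens_eq_image hcs hm] at hgen
  obtain ⟨a, ha, rfl⟩ := hgen
  rw [hF.symbolicPower_eq_span]
  exact Ideal.subset_span ⟨a, ha.sdegGE, rfl⟩

theorem IsRegularFamily.span_gens'_eq_top [IsNoetherianRing R]
    (hF : IsRegularFamily F Finset.univ c) (hinj : Function.Injective (monomialIn F))
    (hcs : c < s) (hm : 1 ≤ m)
    (hsub : ∀ M ∈ gens' F c m, M ∈ symbolicPower (starIdeal F c) m) :
    Submodule.span R (Set.range fun M : gens' F c m =>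
      (Submodule.Quotient.mk ⟨M.1, hsub M.1 M.2⟩ : SymbolicQuotient (starIdeal F c) m)) = ⊤ := by
  set V := Submodule.span R (Set.range fun M : gens' F c m =>
      (Submodule.Quotient.mk ⟨M.1, hsub M.1 M.2⟩ : SymbolicQuotient (starIdeal F c) m))
  have hle : symbolicPower (starIdeal F c) m ≤
      (V.comap (Submodule.mkQ _)).map (symbolicPower (starIdeal F c) m).subtype := by
    refine (hF.symbolicPower_eq_span m).le.trans ?_
    refine Ideal.span_le.2 ?_
    rintro _ ⟨b, hb, rfl⟩
    -- Every monomial generator is a multiple of some `F ^ a` in `G`, which is either in `G'` or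
    -- zero in the quotient.
    obtain ⟨a, hab, ha⟩ := exists_isGenExponent_le (by rw [Fintype.card_fin]; exact hcs.le) hm hb
    have hba : b = (b - a) + a := funext fun i => (Nat.sub_add_cancel (hab i)).symm
    rw [hba, monomialIn_add]
    refine Submodule.smul_mem _ _ ?_
    have haN : monomialIn F a ∈ symbolicPower (starIdeal F c) m := by
      rw [hF.symbolicPower_eq_span]
      exact Ideal.subset_span ⟨a, ha.sdegGE, rfl⟩
    refine ⟨⟨monomialIn F a, haN⟩, ?_, rfl⟩
    by_cases ha' : IsGenExponent' c m a
    · have hM : monomialIn F a ∈ gens' F c m := by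
        rw [gens'_eq_image hinj hcs hm]
        exact ⟨a, ha', rfl⟩
      exact Submodule.subset_span ⟨⟨_, hM⟩, rfl⟩
    · change Submodule.mkQ _ _ ∈ V
      have : Submodule.mkQ ((starIdeal F c ^ m).submoduleOf (symbolicPower (starIdeal F c) m))
          ⟨monomialIn F a, haN⟩ = 0 :=
        (Submodule.Quotient.mk_eq_zero _).2 (ha.monomialIn_mem_pow hcs hm ha')
      rw [this]
      exact zero_mem V
  rw [eq_top_iff]
  rintro x -
  obtain ⟨x, rfl⟩ := Submodule.mkQ_surjective _ x
  obtain ⟨y, hy, hyx⟩ := hle x.2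
  rw [← Subtype.ext hyx]
  exact hy

/-- A relation puts `∑ r M * M` into `I ^ m`, which is spanned by monomials with exponents other
than that of the chosen `M`. Moving the remaining terms across makes the independence of monomials
applicable with the kernel of `φ`. -/
theorem IsRegularFamily.map_eq_zero_of_relation {k : Type*} [Field k]
    (hF : IsRegularFamily F Finset.univ c) (hinj : Function.Injective (monomialIn F))
    (hcs : c < s) (hm : 1 ≤ m) (φ : R →+* k) (hφ : ∀ i, φ (F i) = 0)
    (hsub : ∀ M ∈ gens' F c m, M ∈ symbolicPower (starIdeal F c) m) (r : gens' F c m →₀ R)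
    (hr : Finsupp.linearCombination R (fun M : gens' F c m =>
      (Submodule.Quotient.mk ⟨M.1, hsub M.1 M.2⟩ : SymbolicQuotient (starIdeal F c) m)) r = 0)
    (M : gens' F c m) : φ (r M) = 0 := by
  classical
  have h1 : Finsupp.linearCombination R (fun M : gens' F c m => M.1) r ∈ starIdeal F c ^ m := by
    have h2 := Finsupp.apply_linearCombination R
      (Submodule.mkQ ((starIdeal F c ^ m).submoduleOf (symbolicPower (starIdeal F c) m)))
      (fun M : gens' F c m => ⟨M.1, hsub M.1 M.2⟩) r
    have h3 := Finsupp.apply_linearCombination R (symbolicPower (starIdeal F c) m).subtype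
      (fun M : gens' F c m => ⟨M.1, hsub M.1 M.2⟩) r
    have h4 := (Submodule.Quotient.mk_eq_zero _).1 (h2.trans hr)
    change (symbolicPower (starIdeal F c) m).subtype _ ∈ starIdeal F c ^ m at h4
    rw [h3] at h4
    exact h4
  have hM : M.1 ∈ monomialIn F '' {a | IsGenExponent' c m a} :=
    gens'_eq_image hinj hcs hm ▸ M.2
  obtain ⟨a, ha, haM⟩ := hM
  have h2 : Finsupp.linearCombination R (fun M : gens' F c m => M.1) (r.erase M) ∈
      Ideal.span {g | ∃ b, b ≠ a ∧ SdegGE c m b ∧ g = monomialIn F b} := by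
    rw [Finsupp.linearCombination_apply]
    refine Submodule.sum_mem _ fun M' hM' => Submodule.smul_mem _ _ (Ideal.subset_span ?_)
    have hgen : M'.1 ∈ monomialIn F '' {a | IsGenExponent c m a} :=
      gens_eq_image (F := F) hcs hm ▸ M'.2.1
    obtain ⟨b, hb, hbM⟩ := hgen
    refine ⟨b, ?_, hb.sdegGE, hbM.symm⟩
    rintro rfl
    rw [Finsupp.support_erase, Finset.mem_erase] at hM'
    exact hM'.1 (Subtype.ext (hbM.symm.trans haM))
  have h3 : r M * monomialIn F a ∈
      Ideal.span {g | ∃ b, b ≠ a ∧ SdegGE c m b ∧ g = monomialIn F b} := by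
    have h4 := sub_mem (hF.starIdeal_pow_le_of_isGenExponent' hcs ha h1) h2
    have h5 := congrArg (Finsupp.linearCombination R fun M : gens' F c m => M.1)
      (Finsupp.single_add_erase M r)
    rw [map_add, Finsupp.linearCombination_single] at h5
    rwa [← h5, add_sub_cancel_right, ← haM] at h4
  exact hF.mem_of_mul_monomial_mem (I := RingHom.ker φ) hφ ha.1 h3

end Main

end StarConfig

theorem theorem4 {k : Type*} [Field k] (n s c : ℕ) (hc : 1 ≤ c) (hcs : c < s)
    (F : Fin s → MvPolynomial (Fin (n + 1)) k)
    (hF : ∀ i, ∃ d, (F i).IsHomogeneous d)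
    (hreg : ∀ e : Fin (c + 1) ↪ Fin s,
      RingTheory.Sequence.IsRegular (MvPolynomial (Fin (n + 1)) k) (List.ofFn fun j => F (e j)))
    (m : ℕ) (hm : 1 ≤ m) :
    (∃ hsub : ∀ M ∈ StarConfig.gens' F c m,
        M ∈ StarConfig.symbolicPower (StarConfig.starIdeal F c) m,
      StarConfig.IsMinimalGenerating (R := MvPolynomial (Fin (n + 1)) k)
        (fun M : StarConfig.gens' F c m =>
          (Submodule.Quotient.mk ⟨M.1, hsub M.1 M.2⟩ :
            StarConfig.SymbolicQuotient (StarConfig.starIdeal F c) m))) ∧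
    StarConfig.gens' F c m =
      {M | ∃ L, StarConfig.IsNormalForm F M L ∧ StarConfig.sdeg c L = m ∧
        (∀ S ∈ L, s + 1 - c ≤ S.card) ∧ ∃ S ∈ L, s + 2 - c ≤ S.card} ∧
    (StarConfig.gens' F c m).Finite ∧
    StarConfig.sdefect (StarConfig.starIdeal F c) m = (StarConfig.gens' F c m).ncard := by
  have hfam := StarConfig.isRegularFamily_of_isRegular hcs hreg
  have hφ : ∀ i, MvPolynomial.constantCoeff (F i) = 0 := by
    intro i
    obtain ⟨d, hd⟩ := hF i
    -- The swap places `i` at position `0`, so that every `F i` occurs in some regular sequence.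
    let e : Fin (c + 1) ↪ Fin s :=
      (Fin.castLEEmb hcs).trans (Equiv.swap (Fin.castLE hcs 0) i).toEmbedding
    refine StarConfig.constantCoeff_eq_zero_of_isRegular hd (hreg e) ?_
    exact (List.mem_ofFn' _ _).2 ⟨0, by simp [e]⟩
  have hinj := hfam.monomialIn_injective hc
    (RingHom.ker_ne_top (MvPolynomial.constantCoeff (σ := Fin (n + 1)) (R := k))) hφ
  have hsub : ∀ M ∈ StarConfig.gens' F c m,
      M ∈ StarConfig.symbolicPower (StarConfig.starIdeal F c) m :=
    fun M hM => hfam.gens'_subset hcs hm hM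
  have hfin : (StarConfig.gens' F c m).Finite := by
    rw [StarConfig.gens'_eq_image hinj hcs hm]
    exact (StarConfig.finite_isGenExponent' c m).image _
  have hspan := hfam.span_gens'_eq_top hinj hcs hm hsub
  have hrel := hfam.map_eq_zero_of_relation hinj hcs hm MvPolynomial.constantCoeff hφ hsub
  refine ⟨⟨hsub, StarConfig.isMinimalGenerating_of_relations _ hspan hrel⟩,
    StarConfig.gens'_eq_exists_factor hinj hm, hfin, ?_⟩
  have := hfin.fintype
  rw [StarConfig.sdefect, StarConfig.spanFinrank_eq_card_of_relations _ hspan hrel,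
    ← Nat.card_eq_fintype_card, Nat.card_coe_set_eq]
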